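/- Let $k$ be a field. Write $\mathrm{CAlg}_k$ for the category of (small, commutative) $k$-algebras and $\mathrm{ProFin}$ for the category of profinite sets. A condensed set is a sheaf of sets $X:\mathrm{ProFin}^{\mathrm{op}}\to\mathrm{Set}$ for the topology of finite jointly surjective families whose underlying presheaf is accessible; an fpqc sheaf over $k$ is an accessible functor $\mathcal Y:\mathrm{CAlg}_k\to\mathrm{Set}$ that is a sheaf for the fpqc topology (covers: finite families $A\to B_i$ of flat maps, jointly surjective on spectra). For a profinite set $S$ let $\mathcal C(S,k)$ be the $k$-algebra of continuous functions from $S$ to the discrete field $k$. The pétra space $X^{\mathrm{p\acute et}}_k=f^*X$ of a condensed set $X$ is the value at $X$ of the left adjoint $f^*$ of the functor $f_*:\mathcal Y\mapsto \big(S\mapsto\mathcal Y(\mathcal C(S,k))\big)$ from fpqc sheaves over $k$ to condensed sets. (1) For every condensed set $X$, the functor $$A\longmapsto X\big(\pi_0(|\mathrm{Spec}\,A|)\big)$$ on $\mathrm{CAlg}_k$, where the set $\pi_0(|\mathrm{Spec}\,A|)$ of connected components of the spectrum carries the quotient topology (and is thereby a profinite set), is accessible; the pétra space $X^{\mathrm{p\acute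 et}}_k$ exists; and it is the fpqc sheafification of this functor. More precisely, there is a natural map $\iota_A: X(\pi_0(|\mathrm{Spec}\,A|))\to X^{\mathrm{p\acute et}}_k(A)$ which is universal among maps from this functor to fpqc sheaves of sets (accessible or not), and which for $A=\mathcal C(S,k)$ agrees with the unit $X(S)\to X^{\mathrm{p\acute et}}_k(\mathcal C(S,k))$ of the adjunction along the canonical map $S\to\pi_0(|\mathrm{Spec}\,\mathcal C(S,k)|)$ which sends $s$ to the component of the kernel of evaluation at $s$. (2) For every profinite set $S$, viewed as the condensed set $T\mapsto \mathrm{Hom}_{\mathrm{ProFin}}(T,S)$, the pétra space is the affine $k$-scheme $$S^{\mathrm{p\acute et}}_k\simeq \mathrm{Spec}\,\mathcal C(S,k),\qquad A\mapsto \mathrm{Hom}_{\mathrm{CAlg}_k}(\mathcal C(S,k),A),$$ with the unit sending $g:T\to S$ to the pullback of functions $g^*:\mathcal C(S,k)\to\mathcal C(T,k)$. -/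

import Mathlib

open CategoryTheory Opposite TopologicalSpace

universe u

section SpectralComponents

/-- In a quasi-compact, quasi-separated space with a basis of quasi-compact opens (for instance a
spectral space), the intersection of all clopen sets containing a point is preconnected. -/
theorem isPreconnected_iInter_isClopen {T : Type*} [TopologicalSpace T] [CompactSpace T]
    [QuasiSeparatedSpace T] [PrespectralSpace T] (x : T) :
    IsPreconnected (⋂ s : { s : Set T // IsClopen s ∧ x ∈ s }, (s : Set T)) := by
  classical
  set Q : Set T := ⋂ s : { s : Set T // IsClopen s ∧ x ∈ s }, (s : Set T) with hQ
  have hQc : IsClosed Q := isClosed_iInter fun s => s.2.1.1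
  have hxQ : x ∈ Q := Set.mem_iInter.2 fun s => s.2.2
  -- the clopen neighbourhoods of `x` are cofinal among the neighbourhoods of `Q`
  have key : ∀ K : Set T, IsCompact K → Q ∩ K = ∅ →
      ∃ Z : Set T, IsClopen Z ∧ x ∈ Z ∧ Z ∩ K = ∅ := by
    intro K hK h
    rw [Set.inter_comm] at h
    obtain ⟨t, ht⟩ := hK.elim_finite_subfamily_closed
      (fun s : { s : Set T // IsClopen s ∧ x ∈ s } => (s : Set T)) (fun s => s.2.1.1) h
    refine ⟨⋂ i ∈ t, (i : Set T), isClopen_biInter_finset fun i _ => i.2.1,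
      Set.mem_iInter₂.2 fun i _ => i.2.2, ?_⟩
    rw [Set.inter_comm]; exact ht
  -- quasi-compact opens between a quasi-compact set and an open set
  have between : ∀ K U : Set T, IsCompact K → IsOpen U → K ⊆ U →
      ∃ W : Set T, IsOpen W ∧ IsCompact W ∧ K ⊆ W ∧ W ⊆ U := by
    intro K U hK hU hKU
    obtain ⟨W, ⟨hW1, hW2⟩, hW3, hW4⟩ := PrespectralSpace.exists_isCompact_and_isOpen_between
      hK hU hKU |>.imp fun W h => (by
        exact (⟨⟨h.2.1, h.1⟩, h.2.2.1, h.2.2.2⟩ :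
          (IsOpen W ∧ IsCompact W) ∧ K ⊆ W ∧ W ⊆ U))
    exact ⟨W, hW1, hW2, hW3, hW4⟩
  rw [isPreconnected_iff_subset_of_fully_disjoint_closed hQc]
  intro a b ha hb hab hdis
  have hQb : IsCompact (Q ∩ b) := (hQc.inter hb).isCompact
  have hQa : IsCompact (Q ∩ a) := (hQc.inter ha).isCompact
  obtain ⟨U, hU, hUc, haU, hUb⟩ := between (Q ∩ a) bᶜ hQa hb.isOpen_compl
    fun y hy hyb => Set.disjoint_left.1 hdis hy.2 hyb
  obtain ⟨V, hV, hVc, hbV, hVa⟩ := between (Q ∩ b) aᶜ hQb ha.isOpen_compl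
    fun y hy hya => Set.disjoint_left.1 hdis hya hy.2
  have hUV : IsCompact (U ∩ V) := QuasiSeparatedSpace.inter_isCompact U V hU hUc hV hVc
  have hQUV : Q ∩ (U ∩ V) = ∅ := by
    rw [Set.eq_empty_iff_forall_notMem]
    rintro y ⟨hyQ, hyU, hyV⟩
    rcases hab hyQ with h | h
    · exact hVa hyV h
    · exact hUb hyU h
  have hcomp : IsCompact (U ∪ V)ᶜ := (hU.union hV).isClosed_compl.isCompact
  have hQcomp : Q ∩ (U ∪ V)ᶜ = ∅ := by
    rw [Set.eq_empty_iff_forall_notMem]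
    rintro y ⟨hyQ, hy⟩
    rcases hab hyQ with h | h
    · exact hy (Or.inl (haU ⟨hyQ, h⟩))
    · exact hy (Or.inr (hbV ⟨hyQ, h⟩))
  obtain ⟨Z, hZ, hxZ, hZe⟩ := key _ (hUV.union hcomp) (by
    rw [Set.inter_union_distrib_left, hQUV, hQcomp, Set.union_empty])
  have hZ1 : ∀ y ∈ Z, y ∈ U → y ∉ V := fun y hy hyU hyV =>
    (Set.eq_empty_iff_forall_notMem.1 hZe y) ⟨hy, Or.inl ⟨hyU, hyV⟩⟩
  have hZ2 : ∀ y ∈ Z, y ∈ U ∨ y ∈ V := fun y hy => by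
    by_contra h
    exact (Set.eq_empty_iff_forall_notMem.1 hZe y) ⟨hy, Or.inr h⟩
  have clopen : ∀ A B : Set T, IsOpen A → IsOpen B → (∀ y ∈ Z, y ∈ A → y ∉ B) →
      (∀ y ∈ Z, y ∈ A ∨ y ∈ B) → IsClopen (Z ∩ A) := by
    intro A B hA hB h1 h2
    refine ⟨?_, hZ.2.inter hA⟩
    have : Z ∩ A = Z ∩ Bᶜ := by
      ext y
      exact ⟨fun h => ⟨h.1, h1 y h.1 h.2⟩, fun h => ⟨h.1, (h2 y h.1).resolve_right h.2⟩⟩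
    rw [this]
    exact hZ.1.inter hB.isClosed_compl
  rcases hab hxQ with h | h
  · left
    intro y hy
    have h1 : IsClopen (Z ∩ U) := clopen U V hU hV hZ1 hZ2
    have h2 : y ∈ Z ∩ U := Set.mem_iInter.1 hy ⟨Z ∩ U, h1, hxZ, haU ⟨hxQ, h⟩⟩
    exact (hab hy).resolve_right fun hyb => hUb h2.2 hyb
  · right
    intro y hy
    have h1 : IsClopen (Z ∩ V) := clopen V U hV hU (fun y hy hv hu => hZ1 y hy hu hv)
      fun y hy => (hZ2 y hy).symm
    have h2 : y ∈ Z ∩ V := Set.mem_iInter.1 hy ⟨Z ∩ V, h1, hxZ, hbV ⟨hxQ, h⟩⟩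
    exact (hab hy).resolve_left fun hya => hVa h2.2 hya

/-- The space of connected components, with the quotient topology, of a quasi-compact,
quasi-separated space with a basis of quasi-compact opens is Hausdorff. -/
instance t2Space_connectedComponents {T : Type*} [TopologicalSpace T] [CompactSpace T]
    [QuasiSeparatedSpace T] [PrespectralSpace T] : T2Space (ConnectedComponents T) := by
  refine ⟨ConnectedComponents.surjective_coe.forall₂.2 fun a b hne => ?_⟩
  have hex : ∃ U : Set T, IsClopen U ∧ a ∈ U ∧ b ∉ U := by
    by_contra hcon
    push Not at hcon
    apply hne
    rw [ConnectedComponents.coe_eq_coe']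
    refine (isPreconnected_iInter_isClopen b).subset_connectedComponent
      (Set.mem_iInter.2 fun s => s.2.2) (Set.mem_iInter.2 fun s => ?_)
    by_contra ha
    exact hcon (s : Set T)ᶜ s.2.1.compl ha s.2.2
  obtain ⟨U, hU, haU, hbU⟩ := hex
  have hpre : ((↑) : T → ConnectedComponents T) ⁻¹' ((↑) '' U) = U :=
    (connectedComponents_preimage_image U).symm ▸ hU.biUnion_connectedComponent_eq
  have hV : IsClopen (((↑) : T → ConnectedComponents T) '' U) := by
    rw [← ConnectedComponents.isQuotientMap_coe.isClopen_preimage, hpre]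
    exact hU
  refine ⟨_, _, hV.isOpen, hV.compl.isOpen, ⟨a, haU, rfl⟩, fun hb => hbU ?_, disjoint_compl_right⟩
  rw [← hpre]
  exact hb

end SpectralComponents

noncomputable section

section Sites

/-- A condensed set: a sheaf of sets on the category of (small) profinite sets, for the topology
whose covers are the finite jointly surjective families (the coherent topology), whose underlying
presheaf is accessible. -/
structure IsCondensedSet (X : Profinite.{u}ᵒᵖ ⥤ Type u) : Prop where
  isSheaf : Presheaf.IsSheaf (coherentTopology Profinite.{u}) X
  isAccessible : X.IsAccessible.{u}

variable (k : Type u) [Field k]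

/-- The fpqc covers of an affine `k`-scheme by affine `k`-schemes: finite families `A ⟶ B i` of flat
homomorphisms of `k`-algebras that are jointly surjective on prime spectra. -/
def fpqcPrecoverageAlg : Precoverage (CommAlgCat.{u} k)ᵒᵖ where
  coverings A := { R | ∃ (n : ℕ) (B : Fin n → CommAlgCat.{u} k) (f : ∀ i, A.unop ⟶ B i),
    (∀ i, (f i).hom.toRingHom.Flat) ∧
    (∀ p : PrimeSpectrum A.unop, ∃ (i : Fin n) (q : PrimeSpectrum (B i)),
      PrimeSpectrum.comap (f i).hom.toRingHom q = p) ∧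
    R = Presieve.ofArrows (fun i => op (B i)) (fun i => (f i).op) }

/-- The fpqc topology on the opposite of the category of `k`-algebras. -/
def fpqcTopologyAlg : GrothendieckTopology (CommAlgCat.{u} k)ᵒᵖ :=
  (fpqcPrecoverageAlg k).toGrothendieck

variable {k}

/-- The sheaf condition for the fpqc topology, for a functor from `k`-algebras to sets. -/
def SatisfiesFpqcDescent (F : CommAlgCat.{u} k ⥤ Type u) : Prop :=
  Presheaf.IsSheaf (fpqcTopologyAlg k) (unopUnop (CommAlgCat.{u} k) ⋙ F)

/-- An fpqc sheaf over `k`: a functor from (small) `k`-algebras to sets which satisfies fpqc descent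
and is accessible. -/
structure IsFpqcSheaf (F : CommAlgCat.{u} k ⥤ Type u) : Prop where
  isSheaf : SatisfiesFpqcDescent F
  isAccessible : F.IsAccessible.{u}

/-- `ι : F ⟶ P` exhibits the fpqc sheaf `P` as the fpqc sheafification of the functor `F`: every map
from `F` to a functor satisfying fpqc descent factors uniquely through `ι`. -/
structure IsFpqcSheafification {F P : CommAlgCat.{u} k ⥤ Type u} (ι : F ⟶ P) : Prop where
  isFpqcSheaf : IsFpqcSheaf P
  existsUnique_fac : ∀ Q : CommAlgCat.{u} k ⥤ Type u, SatisfiesFpqcDescent Q →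
    ∀ g : F ⟶ Q, ∃! h : P ⟶ Q, ι ≫ h = g

end Sites

section Petra

variable (k : Type u) [Field k]

/-- The functor `S ↦ C(S, k)` from profinite sets to `k`-algebras, where `k` is discrete (continuous
maps to a discrete space being the same as locally constant maps). -/
def continuousFunctions : Profinite.{u}ᵒᵖ ⥤ CommAlgCat.{u} k where
  obj S := CommAlgCat.of k (LocallyConstant S.unop k)
  map f := CommAlgCat.ofHom (LocallyConstant.comapₐ k f.unop.hom.hom)

/-- The functor of points `A ↦ Hom(B, A)` of the affine `k`-scheme `Spec B`. -/
def specFunctor (B : CommAlgCat.{u} k) : CommAlgCat.{u} k ⥤ Type u :=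
  coyoneda.obj (op B)

/-- Enhanced `k`-points, the functor `f_*`: it sends `Y` to `S ↦ Y (C(S, k))`. -/
def enhancedPoints : (CommAlgCat.{u} k ⥤ Type u) ⥤ (Profinite.{u}ᵒᵖ ⥤ Type u) :=
  (Functor.whiskeringLeft _ _ _).obj (continuousFunctions k)

variable {k}

/-- `(P, η)` is the pétra space of the condensed set `X`, i.e. the value at `X` of the left adjoint
`f^*` of the functor `f_*` from fpqc sheaves to condensed sets, with the unit `η : X ⟶ f_* f^* X` of
the adjunction: `η` is universal among the maps from `X` to enhanced `k`-points of fpqc sheaves. -/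
structure IsPetraSpace (X : Profinite.{u}ᵒᵖ ⥤ Type u) (P : CommAlgCat.{u} k ⥤ Type u)
    (η : X ⟶ (enhancedPoints k).obj P) : Prop where
  isCondensedSet : IsCondensedSet X
  isFpqcSheaf : IsFpqcSheaf P
  existsUnique_fac : ∀ Q : CommAlgCat.{u} k ⥤ Type u, IsFpqcSheaf Q →
    ∀ g : X ⟶ (enhancedPoints k).obj Q, ∃! h : P ⟶ Q, η ≫ (enhancedPoints k).map h = g

/-- The profinite set `π₀|Spec A|`: the set of connected components of the prime spectrum of `A`,
with the quotient topology. -/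
def piZeroSpec (A : CommAlgCat.{u} k) : Profinite.{u} :=
  Profinite.of (_root_.ConnectedComponents (PrimeSpectrum A))

variable (k)

/-- The functor `A ↦ π₀|Spec A|`. -/
def piZeroSpecFunctor : CommAlgCat.{u} k ⥤ Profinite.{u}ᵒᵖ where
  obj A := op (piZeroSpec A)
  map {A B} f := Quiver.Hom.op (X := piZeroSpec B) (Y := piZeroSpec A) <|
    CompHausLike.ofHom _ ⟨(PrimeSpectrum.continuous_comap f.hom.toRingHom).connectedComponentsMap,
      Continuous.connectedComponentsMap_continuous _⟩
  map_id A := by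
    apply Quiver.Hom.unop_inj
    ext x
    obtain ⟨x, rfl⟩ := ConnectedComponents.surjective_coe (α := PrimeSpectrum _) x
    rfl
  map_comp f g := by
    apply Quiver.Hom.unop_inj
    ext x
    obtain ⟨x, rfl⟩ := ConnectedComponents.surjective_coe (α := PrimeSpectrum _) x
    rfl

/-- The functor `A ↦ X (π₀|Spec A|)` on `k`-algebras. -/
def piZeroPresheaf (X : Profinite.{u}ᵒᵖ ⥤ Type u) : CommAlgCat.{u} k ⥤ Type u :=
  piZeroSpecFunctor k ⋙ X

/-- The point of `Spec C(S, k)` given by the kernel of the evaluation at `s`. -/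
def evalPoint (S : Profinite.{u}) (s : S) :
    PrimeSpectrum ((continuousFunctions k).obj (op S)) :=
  ⟨RingHom.ker (LocallyConstant.evalₐ (Y := k) k s : LocallyConstant S k →ₐ[k] k).toRingHom,
    RingHom.ker_isPrime _⟩

theorem continuous_evalPoint (S : Profinite.{u}) : Continuous (evalPoint k S) := by
  rw [PrimeSpectrum.isTopologicalBasis_basic_opens.continuous_iff]
  rintro _ ⟨f, rfl⟩
  exact LocallyConstant.isLocallyConstant (X := S) (Y := k) f ({0}ᶜ : Set k)

/-- The canonical map `S ⟶ π₀|Spec C(S, k)|`, which sends `s` to the connected component of the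
kernel of the evaluation at `s`. -/
def toPiZeroSpec (S : Profinite.{u}) :
    S ⟶ piZeroSpec ((continuousFunctions k).obj (op S)) :=
  CompHausLike.ofHom _ ⟨fun s => (evalPoint k S s : _root_.ConnectedComponents (PrimeSpectrum _)),
    ConnectedComponents.continuous_coe.comp (continuous_evalPoint k S)⟩

/-- The canonical map from a profinite set `S`, viewed as a condensed set, to the enhanced `k`-points
of `Spec C(S, k)`: it sends `g : T ⟶ S` to the pullback of functions `C(S, k) ⟶ C(T, k)`. -/
def profiniteUnit (S : Profinite.{u}) :
    yoneda.obj S ⟶ (enhancedPoints k).obj (specFunctor k ((continuousFunctions k).obj (op S))) where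
  app T := TypeCat.ofHom fun g => (continuousFunctions k).map (Quiver.Hom.op g)
  naturality T T' f := by
    ext g
    exact (continuousFunctions k).map_comp (Quiver.Hom.op g) f

end Petra

end

/-! The functor $\mathcal C(-,k)$ is left adjoint to $A\mapsto\pi_0(|\mathrm{Spec}\,A|)$, viewed as
a functor to $\mathrm{ProFin}^{\mathrm{op}}$ (`continuousFunctionsAdj`): clopen subsets of the
spectrum are idempotents, so a locally constant function on $\pi_0$ becomes a combination of
idempotents of $A$. Precomposition turns this into a bijection between maps $X\circ\pi_0\to Q$ and
maps $X\to f_*Q$ (`piZeroPresheafHomEquiv`). Hence $f^*X$ is the fpqc sheafification of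
$X\circ\pi_0$, provided that this exists and is accessible; both are questions of size.

Existence: $\pi_0(|\mathrm{Spec}\,A|)$ is a quotient of the Stone–Čech compactification
$\beta|\mathrm{Spec}\,A|$ of the underlying set, so $X\circ\pi_0$ embeds into $A\mapsto
X(\beta|\mathrm{Spec}\,A|)$. The latter is already an fpqc sheaf, because ultrafilters lift along
covers and along
$|\mathrm{Spec}(B\otimes_AC)|\to|\mathrm{Spec}\,B|\times_{|\mathrm{Spec}\,A|}|\mathrm{Spec}\,C|$.
The sheafification is the subsheaf generated by the image.

Accessibility: $\pi_0(|\mathrm{Spec}-|)$ turns filtered colimits into limits, so $X\circ\pi_0$ is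
accessible. It also preserves injections, since injective homomorphisms are surjective on $\pi_0$.
The sheafification inherits preservation of injections by flat base change. Each of its sections
comes from a small algebra, because every fpqc family contains a small one with injective maps on
overlaps (`IsFpqcFamily.exists_small`). These two properties imply accessibility
(`isCardinalAccessible_succ_of_injective`).

For a profinite set $S$, Yoneda on both sides identifies maps $S\to f_*Q$ and maps
$\mathrm{Spec}\,\mathcal C(S,k)\to Q$ with $Q(\mathcal C(S,k))$; faithfully flat descent shows that
the affine scheme is a sheaf. -/

/-! ### Fpqc families, pushouts of algebras, and the sheaf condition -/

section FpqcFamilies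

open scoped TensorProduct

/-- Two points of `Spec B` and `Spec C` over the same point of `Spec A` are induced by compatible
homomorphisms to one field. -/
theorem exists_field_of_comap_eq {A B C : Type u} [CommRing A] [CommRing B] [CommRing C]
    (f : A →+* B) (g : A →+* C) (p : PrimeSpectrum B) (q : PrimeSpectrum C)
    (h : PrimeSpectrum.comap f p = PrimeSpectrum.comap g q) :
    ∃ (L : Type u) (_ : Field L) (φ : B →+* L) (ψ : C →+* L), φ.comp f = ψ.comp g ∧
      RingHom.ker φ = p.asIdeal ∧ RingHom.ker ψ = q.asIdeal := by
  let P := (PrimeSpectrum.comap f p).asIdeal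
  let a := Ideal.ResidueField.map P p.asIdeal f rfl
  let b := Ideal.ResidueField.map P q.asIdeal g (congrArg PrimeSpectrum.asIdeal h)
  let _ := a.toAlgebra
  let _ := b.toAlgebra
  -- The tensor product of two field extensions of a field is nonzero; any residue field of it
  -- receives both.
  obtain ⟨m, hm⟩ := Ideal.exists_maximal
    (p.asIdeal.ResidueField ⊗[P.ResidueField] q.asIdeal.ResidueField)
  let c := (Ideal.Quotient.mk m).comp (Algebra.TensorProduct.includeLeftRingHom)
  let d := (Ideal.Quotient.mk m).comp (Algebra.TensorProduct.includeRight.toRingHom)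
  have hcd : c.comp a = d.comp b := by
    change (Ideal.Quotient.mk m).comp (Algebra.TensorProduct.includeLeftRingHom.comp
      (algebraMap P.ResidueField p.asIdeal.ResidueField)) = _
    rw [Algebra.TensorProduct.includeLeftRingHom_comp_algebraMap]
    rfl
  refine ⟨_, Ideal.Quotient.field m, c.comp (algebraMap B p.asIdeal.ResidueField),
    d.comp (algebraMap C q.asIdeal.ResidueField), ?_, ?_, ?_⟩
  · ext x
    have := RingHom.congr_fun hcd (algebraMap A P.ResidueField x)
    have ha : a (algebraMap A P.ResidueField x) = algebraMap B _ (f x) :=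
      Ideal.ResidueField.map_algebraMap ..
    have hb : b (algebraMap A P.ResidueField x) = algebraMap C _ (g x) :=
      Ideal.ResidueField.map_algebraMap ..
    exact (congrArg c ha).symm.trans (this.trans (congrArg d hb))
  · rw [RingHom.ker_comp_of_injective _ (RingHom.injective c)]
    exact Ideal.ker_algebraMap_residueField _
  · rw [RingHom.ker_comp_of_injective _ (RingHom.injective d)]
    exact Ideal.ker_algebraMap_residueField _

variable {k : Type u} [Field k]

/-- A finite family of flat homomorphisms of `k`-algebras that is jointly surjective on spectra. -/
structure IsFpqcFamily {A : CommAlgCat.{u} k} {ι : Type} (B : ι → CommAlgCat.{u} k)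
    (f : ∀ i, A ⟶ B i) : Prop where
  flat : ∀ i, (f i).hom.toRingHom.Flat
  surj : ∀ p : PrimeSpectrum A, ∃ (i : ι) (q : PrimeSpectrum (B i)),
    PrimeSpectrum.comap (f i).hom.toRingHom q = p

theorem CommAlgCat.isScalarTower_of_hom {A B : CommAlgCat.{u} k} (f : A ⟶ B) :
    letI := f.hom.toRingHom.toAlgebra
    IsScalarTower k A B :=
  letI := f.hom.toRingHom.toAlgebra
  .of_algebraMap_eq' f.hom.comp_algebraMap.symm

/-- The pushout `B ⊗[A] C` of `k`-algebras. -/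
noncomputable def pushoutAlg {A B C : CommAlgCat.{u} k} (f : A ⟶ B) (g : A ⟶ C) :
    CommAlgCat.{u} k :=
  letI := f.hom.toRingHom.toAlgebra
  letI := g.hom.toRingHom.toAlgebra
  haveI := CommAlgCat.isScalarTower_of_hom f
  CommAlgCat.of k (B ⊗[A] C)

namespace pushoutAlg

variable {A B C : CommAlgCat.{u} k} (f : A ⟶ B) (g : A ⟶ C)

/-- The first inclusion into the pushout. -/
noncomputable def inl : B ⟶ pushoutAlg f g :=
  letI := f.hom.toRingHom.toAlgebra
  letI := g.hom.toRingHom.toAlgebra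
  haveI := CommAlgCat.isScalarTower_of_hom f
  CommAlgCat.ofHom (Algebra.TensorProduct.includeLeft : B →ₐ[k] B ⊗[A] C)

/-- The second inclusion into the pushout. -/
noncomputable def inr : C ⟶ pushoutAlg f g :=
  letI := f.hom.toRingHom.toAlgebra
  letI := g.hom.toRingHom.toAlgebra
  haveI := CommAlgCat.isScalarTower_of_hom f
  haveI := CommAlgCat.isScalarTower_of_hom g
  CommAlgCat.ofHom ((Algebra.TensorProduct.includeRight : C →ₐ[A] B ⊗[A] C).restrictScalars k)

theorem condition : f ≫ inl f g = g ≫ inr f g := by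
  let _ := f.hom.toRingHom.toAlgebra
  let _ := g.hom.toRingHom.toAlgebra
  have := CommAlgCat.isScalarTower_of_hom f
  have := CommAlgCat.isScalarTower_of_hom g
  ext a
  change algebraMap A B a ⊗ₜ[A] (1 : C) = (1 : B) ⊗ₜ[A] algebraMap A C a
  rw [Algebra.algebraMap_eq_smul_one, Algebra.algebraMap_eq_smul_one, TensorProduct.smul_tmul]

variable {f g}

/-- The homomorphism out of the pushout defined by a commutative square. -/
noncomputable def desc {D : CommAlgCat.{u} k} (i : B ⟶ D) (j : C ⟶ D) (h : f ≫ i = g ≫ j) :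
    pushoutAlg f g ⟶ D :=
  letI := f.hom.toRingHom.toAlgebra
  letI := g.hom.toRingHom.toAlgebra
  haveI := CommAlgCat.isScalarTower_of_hom f
  haveI := CommAlgCat.isScalarTower_of_hom g
  letI := (f ≫ i).hom.toRingHom.toAlgebra
  haveI := CommAlgCat.isScalarTower_of_hom (f ≫ i)
  CommAlgCat.ofHom ((Algebra.TensorProduct.lift (A := B) (B := C) (S := A) (R := A)
    { i.hom with commutes' := fun _ => rfl }
    { j.hom with commutes' := fun a =>
        (congrArg (fun φ : A ⟶ D => φ.hom a) h).symm } fun _ _ => Commute.all _ _).restrictScalars k)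

theorem inl_desc {D : CommAlgCat.{u} k} (i : B ⟶ D) (j : C ⟶ D) (h : f ≫ i = g ≫ j) :
    inl f g ≫ desc i j h = i := by
  ext b
  let _ := f.hom.toRingHom.toAlgebra
  let _ := g.hom.toRingHom.toAlgebra
  change i.hom b * j.hom 1 = i.hom b
  simp

theorem inr_desc {D : CommAlgCat.{u} k} (i : B ⟶ D) (j : C ⟶ D) (h : f ≫ i = g ≫ j) :
    inr f g ≫ desc i j h = j := by
  ext b
  change i.hom 1 * j.hom b = j.hom b
  simp

variable (f g)

theorem flat_inr (hf : f.hom.toRingHom.Flat) : (inr f g).hom.toRingHom.Flat := by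
  let _ := f.hom.toRingHom.toAlgebra
  let _ := g.hom.toRingHom.toAlgebra
  have := CommAlgCat.isScalarTower_of_hom f
  have : Module.Flat A B := hf
  have h : (algebraMap C (C ⊗[A] B)).Flat := RingHom.flat_algebraMap_iff.2 inferInstance
  have h2 := h.comp (RingHom.Flat.of_bijective (f := (Algebra.TensorProduct.comm A C B).toRingHom)
    (Algebra.TensorProduct.comm A C B).bijective)
  exact h2

theorem injective_inl (hf : f.hom.toRingHom.Flat) (hg : Function.Injective g.hom) :
    Function.Injective (inl f g).hom := by
  let _ := f.hom.toRingHom.toAlgebra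
  let _ := g.hom.toRingHom.toAlgebra
  have := CommAlgCat.isScalarTower_of_hom f
  have : Module.Flat A B := hf
  exact Algebra.TensorProduct.includeLeft_injective (S := k) (A := B) (B := C) (R := A) hg

/-- Compatible maps from `B` and `C` to a common field with kernels `p` and `q` factor through the
pushout, and the kernel there is the required point. -/
theorem exists_comap_eq (p : PrimeSpectrum B) (q : PrimeSpectrum C)
    (h : PrimeSpectrum.comap f.hom.toRingHom p = PrimeSpectrum.comap g.hom.toRingHom q) :
    ∃ r : PrimeSpectrum (pushoutAlg f g), PrimeSpectrum.comap (inl f g).hom.toRingHom r = p ∧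
      PrimeSpectrum.comap (inr f g).hom.toRingHom r = q := by
  obtain ⟨L, _, φ, ψ, hφψ, hφ, hψ⟩ := exists_field_of_comap_eq f.hom.toRingHom g.hom.toRingHom p q h
  let _ : Algebra k L := (φ.comp (algebraMap k B)).toAlgebra
  let i : B ⟶ CommAlgCat.of k L := CommAlgCat.ofHom { φ with commutes' := fun _ => rfl }
  let j : C ⟶ CommAlgCat.of k L := CommAlgCat.ofHom
    { ψ with
      commutes' := fun a => by
        change ψ (algebraMap k C a) = φ (algebraMap k B a)
        have := RingHom.congr_fun hφψ (algebraMap k A a)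
        simpa using this.symm }
  have hij : f ≫ i = g ≫ j := by
    ext a
    exact RingHom.congr_fun hφψ a
  refine ⟨⟨RingHom.ker (desc i j hij).hom.toRingHom, RingHom.ker_isPrime _⟩, ?_, ?_⟩
  · ext b
    rw [← hφ]
    change (inl f g ≫ desc i j hij).hom b = 0 ↔ φ b = 0
    rw [inl_desc]
    rfl
  · ext b
    rw [← hψ]
    change (inr f g ≫ desc i j hij).hom b = 0 ↔ ψ b = 0
    rw [inr_desc]
    rfl

end pushoutAlg

/-- The base change of an fpqc family. -/
theorem IsFpqcFamily.pushout {A A' : CommAlgCat.{u} k} {ι : Type} {B : ι → CommAlgCat.{u} k}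
    {f : ∀ i, A ⟶ B i} (hf : IsFpqcFamily B f) (g : A ⟶ A') :
    IsFpqcFamily (fun i => pushoutAlg (f i) g) (fun i => pushoutAlg.inr (f i) g) where
  flat i := pushoutAlg.flat_inr _ _ (hf.flat i)
  surj p := by
    obtain ⟨i, q, hq⟩ := hf.surj (PrimeSpectrum.comap g.hom.toRingHom p)
    obtain ⟨r, -, hr⟩ := pushoutAlg.exists_comap_eq (f i) g q p hq
    exact ⟨i, r, hr⟩

theorem IsFpqcFamily.id (A : CommAlgCat.{u} k) :
    IsFpqcFamily (fun _ : Unit => A) (fun _ => 𝟙 A) where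
  flat _ := RingHom.Flat.id _
  surj p := ⟨(), p, rfl⟩

theorem IsFpqcFamily.comp {A : CommAlgCat.{u} k} {ι : Type} {B : ι → CommAlgCat.{u} k}
    {f : ∀ i, A ⟶ B i} (hf : IsFpqcFamily B f) {κ : ι → Type}
    {C : ∀ i, κ i → CommAlgCat.{u} k} {g : ∀ i j, B i ⟶ C i j}
    (hg : ∀ i, IsFpqcFamily (C i) (g i)) :
    IsFpqcFamily (fun x : Σ i, κ i => C x.1 x.2) (fun x => f x.1 ≫ g x.1 x.2) where
  flat x := (hf.flat x.1).comp ((hg x.1).flat x.2)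
  surj p := by
    obtain ⟨i, q, rfl⟩ := hf.surj p
    obtain ⟨j, r, rfl⟩ := (hg i).surj q
    exact ⟨⟨i, j⟩, r, rfl⟩

theorem IsFpqcFamily.generate_mem {A : CommAlgCat.{u} k} {ι : Type} [Finite ι]
    {B : ι → CommAlgCat.{u} k} {f : ∀ i, A ⟶ B i} (hf : IsFpqcFamily B f) :
    Presieve.ofArrows (fun i => op (B i)) (fun i => (f i).op) ∈ fpqcPrecoverageAlg k (op A) := by
  obtain ⟨n, ⟨e⟩⟩ := Finite.exists_equiv_fin ι
  refine ⟨n, fun i => B (e.symm i), fun i => f (e.symm i), fun i => hf.flat _, fun p => ?_, ?_⟩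
  · obtain ⟨i, q, h⟩ := hf.surj p
    obtain ⟨j, rfl⟩ := e.symm.surjective i
    exact ⟨j, q, h⟩
  · refine funext fun Y => funext fun g => propext ⟨?_, ?_⟩
    · rintro ⟨i⟩
      obtain ⟨j, rfl⟩ := e.symm.surjective i
      exact Presieve.ofArrows.mk j
    · rintro ⟨i⟩
      exact Presieve.ofArrows.mk (e.symm i)

/-- Fpqc families contain identities and are stable under base change and composition, so the
property survives every step generating the topology. -/
theorem exists_isFpqcFamily_of_mem {A : (CommAlgCat.{u} k)ᵒᵖ} {S : Sieve A}
    (hS : S ∈ fpqcTopologyAlg k A) :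
    ∃ (ι : Type) (_ : Finite ι) (B : ι → CommAlgCat.{u} k) (f : ∀ i, A.unop ⟶ B i),
      IsFpqcFamily B f ∧ ∀ i, S (f i).op := by
  induction hS with
  | of X R hR =>
    obtain ⟨n, B, f, h1, h2, rfl⟩ := hR
    exact ⟨Fin n, inferInstance, B, f, ⟨h1, h2⟩,
      fun i => Sieve.le_generate _ _ _ (Presieve.ofArrows.mk i)⟩
  | top X => exact ⟨Unit, inferInstance, _, _, .id X.unop, fun _ => trivial⟩
  | pullback X S _ Y g ih =>
    obtain ⟨ι, _, B, f, hf, h⟩ := ih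
    refine ⟨ι, inferInstance, _, _, hf.pushout g.unop, fun i => ?_⟩
    have := S.downward_closed (h i) (pushoutAlg.inl (f i) g.unop).op
    rw [← op_comp, pushoutAlg.condition] at this
    exact this
  | transitive X S R _ _ ih1 ih2 =>
    obtain ⟨ι, _, B, f, hf, h⟩ := ih1
    choose κ _ C g hg hR using fun i => ih2 (h i)
    exact ⟨Σ i, κ i, inferInstance, _, _, hf.comp hg, fun x => hR x.1 x.2⟩

theorem SatisfiesFpqcDescent.existsUnique {F : CommAlgCat.{u} k ⥤ Type u}
    (hF : SatisfiesFpqcDescent F) {A : CommAlgCat.{u} k} {ι : Type} [Finite ι]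
    {B : ι → CommAlgCat.{u} k} {f : ∀ i, A ⟶ B i} (hf : IsFpqcFamily B f)
    (x : ∀ i, F.obj (B i))
    (hx : ∀ i j, F.map (pushoutAlg.inl (f i) (f j)) (x i) =
      F.map (pushoutAlg.inr (f i) (f j)) (x j)) :
    ∃! a, ∀ i, F.map (f i) a = x i := by
  have h := ((isSheaf_iff_isSheaf_of_type _ _).1 hF).isSheafFor_of_mem_precoverage hf.generate_mem
  refine (Presieve.isSheafFor_arrows_iff _ _).1 h x fun i j Z g h e => ?_
  have e' : f i ≫ g.unop = f j ≫ h.unop := congrArg Quiver.Hom.unop e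
  have := congrArg (F.map (pushoutAlg.desc _ _ e')) (hx i j)
  rw [← comp_apply, ← comp_apply, ← F.map_comp, ← F.map_comp, pushoutAlg.inl_desc,
    pushoutAlg.inr_desc] at this
  exact this

theorem SatisfiesFpqcDescent.ext {F : CommAlgCat.{u} k ⥤ Type u}
    (hF : SatisfiesFpqcDescent F) {A : CommAlgCat.{u} k} {ι : Type} [Finite ι]
    {B : ι → CommAlgCat.{u} k} {f : ∀ i, A ⟶ B i} (hf : IsFpqcFamily B f) {x y : F.obj A}
    (h : ∀ i, F.map (f i) x = F.map (f i) y) : x = y := by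
  refine (hF.existsUnique hf (fun i => F.map (f i) x) fun i j => ?_).unique (fun _ => rfl)
    fun i => (h i).symm
  rw [← comp_apply, ← comp_apply, ← F.map_comp, ← F.map_comp, pushoutAlg.condition]

theorem satisfiesFpqcDescent_of_existsUnique {F : CommAlgCat.{u} k ⥤ Type u}
    (h : ∀ (A : CommAlgCat.{u} k) (ι : Type) [Finite ι] (B : ι → CommAlgCat.{u} k)
      (f : ∀ i, A ⟶ B i), IsFpqcFamily B f → ∀ x : ∀ i, F.obj (B i),
      (∀ i j, F.map (pushoutAlg.inl (f i) (f j)) (x i) =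
        F.map (pushoutAlg.inr (f i) (f j)) (x j)) →
      ∃! a, ∀ i, F.map (f i) a = x i) :
    SatisfiesFpqcDescent F := by
  refine (isSheaf_iff_isSheaf_of_type _ _).2 fun A S hS => ?_
  have key : ∀ (A : (CommAlgCat.{u} k)ᵒᵖ) (ι : Type) [Finite ι] (B : ι → CommAlgCat.{u} k)
      (f : ∀ i, A.unop ⟶ B i), IsFpqcFamily B f → Presieve.IsSheafFor
        (unopUnop (CommAlgCat.{u} k) ⋙ F)
        (Presieve.ofArrows (X := A) (fun i => op (B i)) (fun i => (f i).op)) := by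
    intro A ι _ B f hf
    refine (Presieve.isSheafFor_arrows_iff _ _).2 fun x hx => ?_
    exact h A.unop ι B f hf x fun i j => hx i j _ (pushoutAlg.inl (f i) (f j)).op
      (pushoutAlg.inr (f i) (f j)).op (congrArg Quiver.Hom.op (pushoutAlg.condition (f i) (f j)))
  have key' := fun (A : (CommAlgCat.{u} k)ᵒᵖ) (ι : Type) [Finite ι] (B : ι → CommAlgCat.{u} k)
    (f : ∀ i, A.unop ⟶ B i) (hf : IsFpqcFamily B f) =>
      (Presieve.isSheafFor_iff_generate _).1 (key A ι B f hf)
  obtain ⟨ι, _, B, f, hf, hfS⟩ := exists_isFpqcFamily_of_mem hS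
  -- Descent passes from the sieve of a family to the larger sieve `S`, once sections are separated
  -- for all pullbacks of the small sieve; these pullbacks again contain fpqc families.
  refine Presieve.isSheafFor_subsieve_aux _
    (S := Sieve.generate (Presieve.ofArrows (X := A) (fun i => op (B i)) (fun i => (f i).op)))
    ?_ (key' A ι B f hf) fun Y g _ => ?_
  · change Sieve.generate _ ≤ S
    rw [Sieve.generate_le_iff]
    rintro _ _ ⟨i⟩
    exact hfS i
  · obtain ⟨κ, _, C, c, hc, hcS⟩ := exists_isFpqcFamily_of_mem
      ((fpqcTopologyAlg k).pullback_stable g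
        (Precoverage.generate_mem_toGrothendieck hf.generate_mem))
    intro x t₁ t₂ h₁ h₂
    refine (key Y κ C c hc).isSeparatedFor.ext ?_
    rintro _ _ ⟨i⟩
    exact (h₁ _ (hcS i)).trans (h₂ _ (hcS i)).symm

end FpqcFamilies

/-! ### Sheafification of subpresheaves of sheaves -/

section SeparatedSheafification

/-- A presheaf which embeds into a sheaf has a sheafification, namely the subsheaf it generates. -/
theorem exists_sheafification_of_mono {C : Type*} [Category* C] (J : GrothendieckTopology C)
    {F G : Cᵒᵖ ⥤ Type u} (m : F ⟶ G) (hm : ∀ U, Function.Injective (m.app U))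
    (hG : Presieve.IsSheaf J G) :
    ∃ (P : Cᵒᵖ ⥤ Type u) (ι : F ⟶ P), Presieve.IsSheaf J P ∧ (∀ U, Function.Injective (ι.app U)) ∧
      (∀ (U : C) (p : P.obj (op U)), ∃ S ∈ J U, ∀ ⦃V⦄ (f : V ⟶ U), S f →
        ∃ x : F.obj (op V), ι.app _ x = P.map f.op p) ∧
      ∀ Q : Cᵒᵖ ⥤ Type u, Presieve.IsSheaf J Q → ∀ g : F ⟶ Q, ∃! h : P ⟶ Q, ι ≫ h = g := by
  let R := Subfunctor.range m
  have hb : ∀ U, Function.Bijective ((Subfunctor.toRange m).app U) := fun U =>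
    ⟨fun x y h => hm U (congrArg Subtype.val h), by rintro ⟨_, x, rfl⟩; exact ⟨x, rfl⟩⟩
  have : ∀ U, IsIso ((Subfunctor.toRange m).app U) := fun U => (isIso_iff_bijective _).2 (hb U)
  have : IsIso (Subfunctor.toRange m) := NatIso.isIso_of_isIso_app _
  refine ⟨(R.sheafify J).toFunctor, Subfunctor.toRange m ≫ Subfunctor.homOfLe (R.le_sheafify J),
    R.sheafify_isSheaf hG, fun U x y h => hm U (congrArg Subtype.val h), fun U p => ?_,
    fun Q hQ g => ?_⟩
  · refine ⟨R.sieveOfSection p.1, p.2, fun V f hf => ?_⟩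
    obtain ⟨x, hx⟩ := hf
    exact ⟨x, Subtype.ext hx⟩
  · refine ⟨R.sheafifyLift (inv (Subfunctor.toRange m) ≫ g) hQ, ?_, fun h hh => ?_⟩
    · refine (Category.assoc _ _ _).trans ?_
      exact (congrArg (Subfunctor.toRange m ≫ ·) (R.to_sheafifyLift _ hQ)).trans
        (IsIso.hom_inv_id_assoc _ _)
    · refine R.to_sheafify_lift_unique hQ _ _ (Eq.trans ?_ (R.to_sheafifyLift _ hQ).symm)
      rw [IsIso.eq_inv_comp, ← Category.assoc]
      exact hh

variable {k : Type u} [Field k]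

/-- A functor on `k`-algebras which embeds into a functor satisfying fpqc descent has an fpqc
sheafification. -/
theorem exists_fpqc_sheafification_of_mono {F G : CommAlgCat.{u} k ⥤ Type u} (m : F ⟶ G)
    (hm : ∀ A, Function.Injective (m.app A)) (hG : SatisfiesFpqcDescent G) :
    ∃ (P : CommAlgCat.{u} k ⥤ Type u) (ι : F ⟶ P), SatisfiesFpqcDescent P ∧
      (∀ A, Function.Injective (ι.app A)) ∧
      (∀ (A : CommAlgCat.{u} k) (p : P.obj A), ∃ (κ : Type) (_ : Finite κ)
        (B : κ → CommAlgCat.{u} k) (f : ∀ i, A ⟶ B i), IsFpqcFamily B f ∧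
        ∀ i, ∃ x : F.obj (B i), ι.app _ x = P.map (f i) p) ∧
      ∀ Q : CommAlgCat.{u} k ⥤ Type u, SatisfiesFpqcDescent Q →
        ∀ g : F ⟶ Q, ∃! h : P ⟶ Q, ι ≫ h = g := by
  obtain ⟨P, ι, hP, hι, hloc, huniv⟩ := exists_sheafification_of_mono (fpqcTopologyAlg k)
    (Functor.whiskerLeft (unopUnop _) m) (fun U => hm _) ((isSheaf_iff_isSheaf_of_type _ _).1 hG)
  refine ⟨opOp _ ⋙ P, Functor.whiskerLeft (opOp _) ι, (isSheaf_iff_isSheaf_of_type _ _).2 hP,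
    fun A => hι _, fun A p => ?_, fun Q hQ g => ?_⟩
  · obtain ⟨S, hS, h⟩ := hloc (op A) p
    obtain ⟨κ, _, B, f, hf, hfS⟩ := exists_isFpqcFamily_of_mem hS
    exact ⟨κ, inferInstance, B, f, hf, fun i => h _ (hfS i)⟩
  · obtain ⟨h, hh, hu⟩ := huniv _ ((isSheaf_iff_isSheaf_of_type _ _).1 hQ)
      (Functor.whiskerLeft (unopUnop _) g)
    refine ⟨Functor.whiskerLeft (opOp _) h, congrArg (Functor.whiskerLeft (opOp _)) hh,
      fun h' hh' => ?_⟩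
    have := hu (Functor.whiskerLeft (unopUnop _) h')
      (congrArg (Functor.whiskerLeft (unopUnop _)) hh')
    exact congrArg (Functor.whiskerLeft (opOp _)) this

end SeparatedSheafification

/-! ### Gluing in condensed sets -/

section CondensedGluing

/-- Gluing for a condensed set along a finite jointly surjective family, where the overlaps are
covered by given profinite sets. -/
theorem IsCondensedSet.existsUnique_glue {X : Profinite.{u}ᵒᵖ ⥤ Type u} (hX : IsCondensedSet X)
    {ι : Type} [Finite ι] {S : Profinite.{u}} {T : ι → Profinite.{u}} (f : ∀ i, T i ⟶ S)
    (hf : ∀ s : S, ∃ (i : ι) (t : T i), f i t = s)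
    {W : ι → ι → Profinite.{u}} (a : ∀ i j, W i j ⟶ T i) (b : ∀ i j, W i j ⟶ T j)
    (hW : ∀ i j (t : T i) (t' : T j), f i t = f j t' → ∃ w : W i j, a i j w = t ∧ b i j w = t')
    (hab : ∀ i j, a i j ≫ f i = b i j ≫ f j)
    (x : ∀ i, X.obj (op (T i))) (hx : ∀ i j, X.map (a i j).op (x i) = X.map (b i j).op (x j)) :
    ∃! y : X.obj (op S), ∀ i, X.map (f i).op y = x i := by
  have sheafFor : ∀ {κ : Type} [Finite κ] {S : Profinite.{u}} {T : κ → Profinite.{u}}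
      (f : ∀ i, T i ⟶ S), (∀ s : S, ∃ (i : κ) (t : T i), f i t = s) →
      (Presieve.ofArrows T f).IsSheafFor X := by
    intro κ _ S T f hf
    rw [Presieve.isSheafFor_iff_generate]
    exact (isSheaf_iff_isSheaf_of_type _ _).1 hX.isSheaf _
      ((coherentTopology.mem_sieves_iff_hasEffectiveEpiFamily _).2
        ⟨κ, inferInstance, T, f, Profinite.effectiveEpiFamily_of_jointly_surjective T f hf,
          fun i => Sieve.le_generate _ _ _ (Presieve.ofArrows.mk i)⟩)
  refine (Presieve.isSheafFor_arrows_iff _ _).1 (sheafFor f hf) x fun i j Z g h e => ?_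
  -- `W i j` surjects onto the fibre product, and a condensed set is separated for this surjection,
  -- so compatibility on `W i j` is compatibility on the fibre product.
  let w : W i j ⟶ CompHausLike.pullback (f i) (f j) := CompHausLike.pullback.lift _ _ (a i j) (b i j) (hab i j)
  have hw : ∀ z : CompHausLike.pullback (f i) (f j), ∃ (_ : Unit) (v : W i j),
      w v = z := by
    intro z
    obtain ⟨v, hv1, hv2⟩ := hW i j _ _ z.2
    exact ⟨(), v, Subtype.ext (Prod.ext hv1 hv2)⟩
  have hinj := ((sheafFor (fun _ : Unit => w) hw).isSeparatedFor)
  have key : X.map (CompHausLike.pullback.fst (f i) (f j)).op (x i) =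
      X.map (CompHausLike.pullback.snd (f i) (f j)).op (x j) := by
    refine hinj.ext ?_
    rintro _ _ ⟨⟩
    rw [← comp_apply, ← comp_apply, ← X.map_comp, ← X.map_comp, ← op_comp, ← op_comp,
      CompHausLike.pullback.lift_fst, CompHausLike.pullback.lift_snd]
    exact hx i j
  have := congrArg (X.map (CompHausLike.pullback.lift _ _ g h e).op) key
  rwa [← comp_apply, ← comp_apply, ← X.map_comp, ← X.map_comp, ← op_comp, ← op_comp,
      CompHausLike.pullback.lift_fst, CompHausLike.pullback.lift_snd] at this

/-- A condensed set is injective on restriction along surjections. -/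
theorem IsCondensedSet.injective_map {X : Profinite.{u}ᵒᵖ ⥤ Type u} (hX : IsCondensedSet X)
    {S T : Profinite.{u}} (f : T ⟶ S) (hf : Function.Surjective f) :
    Function.Injective (X.map f.op) := by
  intro x y h
  refine (hX.existsUnique_glue (ι := Unit) (fun _ => f) (fun s => ⟨(), hf s⟩)
    (fun _ _ => CompHausLike.pullback.fst f f) (fun _ _ => CompHausLike.pullback.snd f f) ?_
    (fun _ _ => (CompHausLike.pullback.condition _ _)) (fun _ => X.map f.op x) fun _ _ => ?_).unique
      (fun _ => rfl) fun _ => h.symm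
  · exact fun _ _ t t' h => ⟨⟨(t, t'), h⟩, rfl, rfl⟩
  · rw [← comp_apply, ← comp_apply, ← X.map_comp, ← X.map_comp, ← op_comp, ← op_comp,
      (CompHausLike.pullback.condition _ _)]

end CondensedGluing

/-! ### The sheaf of values on Stone–Čech compactifications of spectra -/

section UltrafilterSheaf

/-- For maps of sets with common target, compatible ultrafilters on the sources come from an
ultrafilter on any set surjecting onto the fibre product. -/
theorem Ultrafilter.exists_map_eq_map {X Y Z W : Type*} (f : X → Z) (g : Y → Z) (a : W → X)
    (b : W → Y) (hW : ∀ x y, f x = g y → ∃ w, a w = x ∧ b w = y) (U : Ultrafilter X)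
    (V : Ultrafilter Y) (h : U.map f = V.map g) :
    ∃ w : Ultrafilter W, w.map a = U ∧ w.map b = V := by
  -- Both pulled-back filters have a common refinement because for `s ∈ U` and `t ∈ V` some point of
  -- `t` lies over the same point as one of `s`.
  have hne : (Filter.comap a (U : Filter X) ⊓ Filter.comap b (V : Filter Y)).NeBot := by
    refine Filter.inf_neBot_iff.2 ?_
    rintro _ ⟨s, hs, hs'⟩ _ ⟨t, ht, ht'⟩
    have h1 : f '' s ∈ V.map g := h ▸ Filter.image_mem_map hs
    obtain ⟨y, hyt, x, hx, hxy⟩ := V.nonempty_of_mem (Filter.inter_mem ht h1)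
    obtain ⟨w, rfl, rfl⟩ := hW x y hxy
    exact ⟨w, hs' hx, ht' hyt⟩
  refine ⟨Ultrafilter.of (Filter.comap a (U : Filter X) ⊓ Filter.comap b (V : Filter Y)), ?_, ?_⟩
  · refine Ultrafilter.coe_le_coe.1 ?_
    rw [Ultrafilter.coe_map]
    exact Filter.map_le_iff_le_comap.2 ((Ultrafilter.of_le _).trans inf_le_left)
  · refine Ultrafilter.coe_le_coe.1 ?_
    rw [Ultrafilter.coe_map]
    exact Filter.map_le_iff_le_comap.2 ((Ultrafilter.of_le _).trans inf_le_right)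

/-- An ultrafilter on the target of a finite jointly surjective family of maps is the image of an
ultrafilter on one of the sources. -/
theorem Ultrafilter.exists_map_eq {ι : Type*} [Finite ι] {Y : ι → Type*} {Z : Type*}
    (f : ∀ i, Y i → Z) (hf : ∀ z, ∃ i y, f i y = z) (U : Ultrafilter Z) :
    ∃ (i : ι) (V : Ultrafilter (Y i)), V.map (f i) = U := by
  have h : (⋃ i ∈ (Set.univ : Set ι), Set.range (f i)) ∈ U := by
    rw [show (⋃ i ∈ (Set.univ : Set ι), Set.range (f i)) = Set.univ from
      Set.eq_univ_of_forall fun z => by simpa using hf z]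
    exact Filter.univ_mem
  obtain ⟨i, -, hi⟩ := (Ultrafilter.finite_biUnion_mem_iff Set.finite_univ).1 h
  have hne : (Filter.comap (f i) (U : Filter Z)).NeBot := by
    rw [Filter.comap_neBot_iff]
    intro t ht
    obtain ⟨_, h1, y, rfl⟩ := U.nonempty_of_mem (Filter.inter_mem ht hi)
    exact ⟨y, h1⟩
  refine ⟨i, Ultrafilter.of (Filter.comap (f i) (U : Filter Z)), Ultrafilter.coe_le_coe.1 ?_⟩
  rw [Ultrafilter.coe_map]
  exact Filter.map_le_iff_le_comap.2 (Ultrafilter.of_le _)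

/-- The Stone–Čech compactification of a discrete set, as a functor to profinite sets. -/
def ultrafilterProfinite (α : Type u) : Profinite.{u} := Profinite.of (Ultrafilter α)

/-- The map of Stone–Čech compactifications induced by a map of sets. -/
def ultrafilterProfinite.map {α β : Type u} (f : α → β) :
    ultrafilterProfinite α ⟶ ultrafilterProfinite β :=
  CompHausLike.ofHom _ ⟨Ultrafilter.map f, continuous_generateFrom_iff.2 <| by
    rintro _ ⟨s, rfl⟩
    exact ultrafilter_isOpen_basic (f ⁻¹' s)⟩

theorem ultrafilterProfinite.hom_ext {α : Type u} {S : Profinite.{u}}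
    {f g : ultrafilterProfinite α ⟶ S} (h : ∀ a : α, f (pure a : Ultrafilter α) =
      g (pure a : Ultrafilter α)) : f = g := by
  ext x
  exact congrFun (denseRange_pure.equalizer f.hom.hom.continuous
    g.hom.hom.continuous (funext h)) x

variable (k : Type u) [Field k]

/-- The functor sending `A` to the Stone–Čech compactification of the discrete set `|Spec A|`. -/
def ultrafilterSpecFunctor : CommAlgCat.{u} k ⥤ Profinite.{u}ᵒᵖ where
  obj A := op (ultrafilterProfinite (PrimeSpectrum A))
  map f := (ultrafilterProfinite.map (PrimeSpectrum.comap f.hom.toRingHom)).op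
  map_id A := by
    apply Quiver.Hom.unop_inj
    exact ultrafilterProfinite.hom_ext fun a => Ultrafilter.map_pure _ _
  map_comp f g := by
    apply Quiver.Hom.unop_inj
    exact ultrafilterProfinite.hom_ext fun a => rfl

variable {k}

/-- Passing to ultrafilters turns a finite cover of spectra into a finite cover of profinite sets,
and the spectra of the pushouts still cover the overlaps. -/
theorem IsCondensedSet.satisfiesFpqcDescent_ultrafilterSpec {X : Profinite.{u}ᵒᵖ ⥤ Type u}
    (hX : IsCondensedSet X) : SatisfiesFpqcDescent (ultrafilterSpecFunctor k ⋙ X) := by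
  refine satisfiesFpqcDescent_of_existsUnique fun A ι _ B f hf x hx => ?_
  refine hX.existsUnique_glue (fun i => ((ultrafilterSpecFunctor k).map (f i)).unop) ?_
    (W := fun i j => ((ultrafilterSpecFunctor k).obj (pushoutAlg (f i) (f j))).unop)
    (fun i j => ((ultrafilterSpecFunctor k).map (pushoutAlg.inl (f i) (f j))).unop)
    (fun i j => ((ultrafilterSpecFunctor k).map (pushoutAlg.inr (f i) (f j))).unop)
    (fun i j t t' h => ?_) (fun i j => ?_) x hx
  · exact Ultrafilter.exists_map_eq _ hf.surj
  · exact Ultrafilter.exists_map_eq_map _ _ _ _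
      (fun p q h => pushoutAlg.exists_comap_eq (f i) (f j) p q h) _ _ h
  · rw [← unop_comp, ← unop_comp, ← Functor.map_comp, ← Functor.map_comp, pushoutAlg.condition]

variable (k) in
/-- The natural surjection from the Stone–Čech compactification of `|Spec A|` to `π₀|Spec A|`. -/
noncomputable def piZeroToUltrafilter : piZeroSpecFunctor k ⟶ ultrafilterSpecFunctor k where
  app A := Quiver.Hom.op (X := ultrafilterProfinite (PrimeSpectrum A)) (Y := piZeroSpec A) <|
    CompHausLike.ofHom _
      ⟨Ultrafilter.extend (fun p => (p : _root_.ConnectedComponents (PrimeSpectrum A))),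
        continuous_ultrafilter_extend _⟩
  naturality A B f := by
    apply Quiver.Hom.unop_inj
    refine ultrafilterProfinite.hom_ext fun a => ?_
    exact (congrArg ((piZeroSpecFunctor k).map f).unop
      (ultrafilter_extend_pure (γ := piZeroSpec B) _root_.ConnectedComponents.mk a)).trans
        (ultrafilter_extend_pure (γ := piZeroSpec A) _root_.ConnectedComponents.mk
          (PrimeSpectrum.comap f.hom.toRingHom a)).symm

/-- All algebras form a large site, so a colimit over all covers is avoided: the sheafification is
cut out inside an explicit sheaf. Injectivity and local surjectivity of the map are recorded for the
proof of accessibility. -/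
theorem IsCondensedSet.exists_piZeroPresheaf_sheafification {X : Profinite.{u}ᵒᵖ ⥤ Type u}
    (hX : IsCondensedSet X) :
    ∃ (P : CommAlgCat.{u} k ⥤ Type u) (ι : piZeroPresheaf k X ⟶ P), SatisfiesFpqcDescent P ∧
      (∀ A, Function.Injective (ι.app A)) ∧
      (∀ (A : CommAlgCat.{u} k) (p : P.obj A), ∃ (κ : Type) (_ : Finite κ)
        (B : κ → CommAlgCat.{u} k) (f : ∀ i, A ⟶ B i), IsFpqcFamily B f ∧
        ∀ i, ∃ x : (piZeroPresheaf k X).obj (B i), ι.app _ x = P.map (f i) p) ∧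
      ∀ Q : CommAlgCat.{u} k ⥤ Type u, SatisfiesFpqcDescent Q →
        ∀ g : piZeroPresheaf k X ⟶ Q, ∃! h : P ⟶ Q, ι ≫ h = g := by
  refine exists_fpqc_sheafification_of_mono (Functor.whiskerRight (piZeroToUltrafilter k) X)
    (fun A => hX.injective_map _ fun c => ?_) hX.satisfiesFpqcDescent_ultrafilterSpec
  obtain ⟨p, rfl⟩ := ConnectedComponents.surjective_coe c
  exact ⟨(pure p : Ultrafilter (PrimeSpectrum A)), ultrafilter_extend_pure (γ := piZeroSpec A) _ _⟩

end UltrafilterSheaf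

/-! ### Small algebras are presentable; a criterion for accessibility -/

section Accessibility

open Cardinal Limits

variable {k : Type u} [Field k]

instance CommAlgCat.preservesFilteredColimits_forget :
    PreservesFilteredColimits (forget (CommAlgCat.{u} k)) := by
  have : PreservesFilteredColimits ((commAlgCatEquivUnder (.of k)).functor ⋙
    Under.forget (CommRingCat.of k) ⋙ forget CommRingCat.{u}) := inferInstance
  exact this

variable {J : Type u} [SmallCategory J] {K : J ⥤ CommAlgCat.{u} k} {c : Cocone K}

theorem CommAlgCat.exists_rep_of_isColimit [IsFiltered J] (hc : IsColimit c) (a : c.pt) :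
    ∃ (j : J) (x : K.obj j), (c.ι.app j).hom x = a :=
  Types.jointly_surjective_of_isColimit (isColimitOfPreserves (forget (CommAlgCat.{u} k)) hc) a

theorem CommAlgCat.exists_eq_of_isColimit [IsFiltered J] (hc : IsColimit c) {j : J}
    {x y : K.obj j} (h : (c.ι.app j).hom x = (c.ι.app j).hom y) :
    ∃ (i : J) (f : j ⟶ i), (K.map f).hom x = (K.map f).hom y :=
  (Types.FilteredColimit.isColimit_eq_iff'
    (isColimitOfPreserves (forget (CommAlgCat.{u} k)) hc) x y).1 h

/-- `E` is presented with its own elements as generators and the kernel of `MvPolynomial E k → E` as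
relations. Both sets have fewer than `κ` elements, so the images of all generators lift to one stage
and all relations hold at a later one. -/
theorem CommAlgCat.exists_hom_of_isColimit (κ : Cardinal.{u}) [hκ : Fact κ.IsRegular]
    [IsCardinalFiltered J κ] (hc : IsColimit c) {E : CommAlgCat.{u} k}
    (hE : #(MvPolynomial E k) < κ) (φ : E ⟶ c.pt) :
    ∃ (j : J) (ψ : E ⟶ K.obj j), ψ ≫ c.ι.app j = φ := by
  have := isFiltered_of_isCardinalFiltered J κ
  choose j₀ x₀ hx₀ using fun e : E => CommAlgCat.exists_rep_of_isColimit hc (φ.hom e)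
  have hE' : HasCardinalLT E κ := (hasCardinalLT_iff_cardinal_mk_lt _ _).2
    ((Cardinal.mk_le_of_injective (MvPolynomial.X_injective (σ := E) (R := k))).trans_lt hE)
  let j₁ := IsCardinalFiltered.max j₀ hE'
  let x₁ (e : E) : K.obj j₁ := (K.map (IsCardinalFiltered.toMax j₀ hE' e)).hom (x₀ e)
  have hx₁ (e : E) : (c.ι.app j₁).hom (x₁ e) = φ.hom e := by
    rw [← hx₀ e]
    exact congrArg (fun f : K.obj (j₀ e) ⟶ c.pt => f.hom (x₀ e)) (c.w _)
  let θ : MvPolynomial E k →ₐ[k] K.obj j₁ := MvPolynomial.aeval x₁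
  let π : MvPolynomial E k →ₐ[k] E := MvPolynomial.aeval id
  have hπ : Function.Surjective π := fun e => ⟨MvPolynomial.X e, by simp [π]⟩
  have hθ : (c.ι.app j₁).hom.comp θ = φ.hom.comp π :=
    MvPolynomial.algHom_ext fun e => by simp [θ, π, hx₁]
  choose j₂ f₂ hf₂ using fun r : RingHom.ker π => CommAlgCat.exists_eq_of_isColimit hc
    (x := θ r.1) (y := 0) (by
      rw [map_zero]
      exact (DFunLike.congr_fun hθ r.1).trans ((congrArg φ.hom r.2).trans (map_zero _)))
  obtain ⟨m, a, b, hab⟩ := IsCardinalFiltered.wideSpan (κ := κ) f₂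
    ((hasCardinalLT_iff_cardinal_mk_lt _ _).2 ((mk_subtype_le _).trans_lt hE))
  have hker : ∀ r ∈ RingHom.ker π, ((K.map b).hom.comp θ) r = 0 := by
    intro r hr
    have h := congrArg (K.map (a ⟨r, hr⟩)).hom (hf₂ ⟨r, hr⟩)
    rw [map_zero, map_zero] at h
    rw [← hab ⟨r, hr⟩, K.map_comp]
    exact h
  let ψ : E →ₐ[k] K.obj m := (Ideal.Quotient.liftₐ (RingHom.ker π) _ hker).comp
    (Ideal.quotientKerAlgEquivOfSurjective hπ).symm.toAlgHom
  have hψ : ψ.comp π = (K.map b).hom.comp θ := by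
    ext e
    have : (Ideal.quotientKerAlgEquivOfSurjective hπ).symm (π (MvPolynomial.X e)) =
      Ideal.Quotient.mk _ (MvPolynomial.X e) := by
      rw [AlgEquiv.symm_apply_eq]
      rfl
    exact congrArg (Ideal.Quotient.liftₐ (RingHom.ker π) _ hker) this
  refine ⟨m, CommAlgCat.ofHom ψ, ?_⟩
  ext e
  obtain ⟨r, rfl⟩ := hπ e
  have h1 : ψ (π r) = (K.map b).hom (θ r) := DFunLike.congr_fun hψ r
  change (c.ι.app m).hom (ψ (π r)) = φ.hom (π r)
  rw [h1]
  refine Eq.trans ?_ (DFunLike.congr_fun hθ r)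
  exact congrArg (fun f : K.obj j₁ ⟶ c.pt => f.hom (θ r)) (c.w b)

theorem CommAlgCat.exists_comp_eq_of_isColimit (κ : Cardinal.{u}) [hκ : Fact κ.IsRegular]
    [IsCardinalFiltered J κ] (hc : IsColimit c) {E : CommAlgCat.{u} k}
    (hE : #E < κ) {j : J} {ψ ψ' : E ⟶ K.obj j} (h : ψ ≫ c.ι.app j = ψ' ≫ c.ι.app j) :
    ∃ (i : J) (f : j ⟶ i), ψ ≫ K.map f = ψ' ≫ K.map f := by
  have := isFiltered_of_isCardinalFiltered J κ
  choose j₂ f₂ hf₂ using fun e : E => CommAlgCat.exists_eq_of_isColimit hc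
    (x := ψ.hom e) (y := ψ'.hom e) (congrArg (fun f : E ⟶ c.pt => f.hom e) h)
  obtain ⟨m, a, b, hab⟩ := IsCardinalFiltered.wideSpan (κ := κ) f₂
    ((hasCardinalLT_iff_cardinal_mk_lt _ _).2 hE)
  refine ⟨m, b, ?_⟩
  ext e
  have h := congrArg (K.map (a e)).hom (hf₂ e)
  rw [← hab e, K.map_comp]
  exact h

theorem cardinalMk_mvPolynomial_lt_succ {μ : Cardinal.{u}} (hμ : ℵ₀ ≤ μ) (hk : #k ≤ μ)
    {E : Type u} (hE : #E ≤ μ) : #(MvPolynomial E k) < Order.succ μ :=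
  Order.lt_succ_iff.2 (MvPolynomial.cardinalMk_le_max.trans (max_le (max_le hk hE) hμ))

theorem Subalgebra.cardinalMk_adjoin_le_of_le {μ : Cardinal.{u}} (hμ : ℵ₀ ≤ μ) (hk : #k ≤ μ)
    {A : Type u} [CommRing A] [Algebra k A] {s : Set A} (hs : #s ≤ μ) :
    #(Algebra.adjoin k s) ≤ μ := by
  rw [Algebra.adjoin_eq_range]
  exact (Cardinal.mk_range_le (f := MvPolynomial.aeval ((↑) : s → A))).trans
    (MvPolynomial.cardinalMk_le_max.trans (max_le (max_le hk hs) hμ))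

/-- A functor on `k`-algebras which preserves injections and all of whose elements come from
small algebras is accessible. -/
theorem isCardinalAccessible_succ_of_injective {P : CommAlgCat.{u} k ⥤ Type u} {μ : Cardinal.{u}}
    (hμ : ℵ₀ ≤ μ) (hk : #k ≤ μ) [Fact (Order.succ μ).IsRegular]
    (hinj : ∀ ⦃A B : CommAlgCat.{u} k⦄ (f : A ⟶ B), Function.Injective f.hom →
      Function.Injective (P.map f))
    (hsmall : ∀ (A : CommAlgCat.{u} k) (p : P.obj A), ∃ (C : CommAlgCat.{u} k) (g : C ⟶ A)
      (x : P.obj C), #C ≤ μ ∧ P.map g x = p) :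
    P.IsCardinalAccessible (Order.succ μ) where
  preservesColimitOfShape J _ _ := ⟨fun {K} => ⟨fun {c} hc => by
    have := isFiltered_of_isCardinalFiltered J (Order.succ μ)
    refine ⟨Types.FilteredColimit.isColimitOf' _ _ (fun p => ?_) fun j x y h => ?_⟩
    · obtain ⟨C, g, x, hC, rfl⟩ := hsmall _ p
      obtain ⟨j, ψ, rfl⟩ := CommAlgCat.exists_hom_of_isColimit (Order.succ μ) hc
        (cardinalMk_mvPolynomial_lt_succ hμ hk hC) g
      refine ⟨j, P.map ψ x, ?_⟩
      exact ConcreteCategory.congr_hom (P.map_comp _ _) x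
    · obtain ⟨C, g, x, hC, rfl⟩ := hsmall _ x
      obtain ⟨C', g', x', hC', rfl⟩ := hsmall _ y
      let D := Algebra.adjoin k (Set.range g.hom ∪ Set.range g'.hom)
      have hD : #D ≤ μ := Subalgebra.cardinalMk_adjoin_le_of_le hμ hk
        ((Cardinal.mk_union_le _ _).trans (Cardinal.add_le_of_le hμ
          (Cardinal.mk_range_le.trans hC) (Cardinal.mk_range_le.trans hC')))
      let i : CommAlgCat.of k D ⟶ K.obj j := CommAlgCat.ofHom D.val
      let d : C ⟶ CommAlgCat.of k D := CommAlgCat.ofHom (g.hom.codRestrict D fun a =>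
        Algebra.subset_adjoin (Or.inl ⟨a, rfl⟩))
      let d' : C' ⟶ CommAlgCat.of k D := CommAlgCat.ofHom (g'.hom.codRestrict D fun a =>
        Algebra.subset_adjoin (Or.inr ⟨a, rfl⟩))
      have hd : d ≫ i = g := rfl
      have hd' : d' ≫ i = g' := rfl
      -- The two elements agree over the colimit, hence already over the image `E` of `D`, which
      -- embeds there. As `E` is small, its inclusion lifts to a stage, and at a later stage `l` the
      -- map `D ⟶ K.obj l` factors through `E`.
      let E := (i ≫ c.ι.app j).hom.range
      let q : CommAlgCat.of k D ⟶ CommAlgCat.of k E :=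
        CommAlgCat.ofHom (i ≫ c.ι.app j).hom.rangeRestrict
      let e : CommAlgCat.of k E ⟶ c.pt := CommAlgCat.ofHom E.val
      have hqe : q ≫ e = i ≫ c.ι.app j := rfl
      have hE : #E ≤ μ := (Cardinal.mk_le_of_surjective
        (i ≫ c.ι.app j).hom.rangeRestrict_surjective).trans hD
      have h1 : P.map (d ≫ q) x = P.map (d' ≫ q) x' := by
        apply hinj e Subtype.val_injective
        rw [← comp_apply, ← comp_apply, ← P.map_comp, ← P.map_comp, Category.assoc,
          Category.assoc, hqe, ← Category.assoc, ← Category.assoc, hd, hd', P.map_comp, P.map_comp,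
          comp_apply, comp_apply]
        exact h
      obtain ⟨j', ψ, hψ⟩ := CommAlgCat.exists_hom_of_isColimit (Order.succ μ) hc
        (cardinalMk_mvPolynomial_lt_succ hμ hk hE) e
      let m := IsFiltered.max j j'
      obtain ⟨l, f, hf⟩ := CommAlgCat.exists_comp_eq_of_isColimit (Order.succ μ) hc
        (Order.lt_succ_iff.2 hD) (j := m) (ψ := i ≫ K.map (IsFiltered.leftToMax j j'))
        (ψ' := q ≫ ψ ≫ K.map (IsFiltered.rightToMax j j')) (by
          simp only [Category.assoc, c.w, hψ, hqe])
      refine ⟨l, IsFiltered.leftToMax j j' ≫ f, ?_⟩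
      have h2 := congrArg (P.map (ψ ≫ K.map (IsFiltered.rightToMax j j') ≫ K.map f)) h1
      rw [← comp_apply, ← comp_apply, ← P.map_comp, ← P.map_comp] at h2
      simp only [Category.assoc] at hf h2
      rw [← hf, ← Category.assoc, ← Category.assoc d', hd, hd', ← K.map_comp, P.map_comp,
        P.map_comp, comp_apply, comp_apply] at h2
      exact h2⟩⟩

end Accessibility

/-! ### Closing up a set under finitary operations with small values -/

section Closure

open Cardinal

theorem Cardinal.mk_iUnion_le_of_le {α ι : Type u} {μ : Cardinal.{u}} (hμ : ℵ₀ ≤ μ) (hι : #ι ≤ μ)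
    {f : ι → Set α} (hf : ∀ i, #(f i) ≤ μ) : #(⋃ i, f i) ≤ μ :=
  (Cardinal.mk_iUnion_le f).trans
    ((mul_le_mul' hι (ciSup_le' hf)).trans (Cardinal.mul_eq_self hμ).le)

/-- A set of bounded cardinality can be closed up under operations on finite families of pairs with
values in small sets without increasing the bound. -/
theorem Set.exists_closed_superset {M : Type u} {μ : Cardinal.{u}} (hμ : ℵ₀ ≤ μ)
    (W : ∀ m : ℕ, (Fin m → M × M) → Set M) (hW : ∀ m c, #(W m c) ≤ μ) (U : Set M) (hU : #U ≤ μ) :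
    ∃ T : Set M, U ⊆ T ∧ #T ≤ μ ∧ ∀ m c, (∀ i, (c i).1 ∈ T ∧ (c i).2 ∈ T) → W m c ⊆ T := by
  -- One step keeps the bound since a set of size at most `μ` has at most `μ` finite families of
  -- pairs. Countably many steps suffice because each finite family lies in one stage.
  let step (V : Set M) : Set M :=
    V ∪ ⋃ x : Σ m, Fin m → V × V, W x.1 fun i => ((x.2 i).1, (x.2 i).2)
  have hstep (V : Set M) (hV : #V ≤ μ) : #(step V) ≤ μ := by
    refine (Cardinal.mk_union_le _ _).trans (Cardinal.add_le_of_le hμ hV ?_)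
    refine Cardinal.mk_iUnion_le_of_le hμ ?_ fun _ => hW _ _
    refine (Cardinal.mk_congr List.equivSigmaTuple).symm.le.trans
      ((Cardinal.mk_list_le_max _).trans (max_le hμ ?_))
    rw [Cardinal.mk_prod, Cardinal.lift_id]
    exact (mul_le_mul' hV hV).trans (Cardinal.mul_eq_self hμ).le
  let T (n : ℕ) : Set M := step^[n] U
  have hTsucc (n : ℕ) : T (n + 1) = step (T n) := Function.iterate_succ_apply' _ _ _
  have hTmono : Monotone T := monotone_nat_of_le_succ fun n => by
    rw [hTsucc]
    exact Set.subset_union_left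
  have hT (n : ℕ) : #(T n) ≤ μ := by
    induction n with
    | zero => exact hU
    | succ n ih =>
      rw [hTsucc]
      exact hstep _ ih
  refine ⟨⋃ n : ULift.{u} ℕ, T n.down, fun x hx => Set.mem_iUnion.2 ⟨⟨0⟩, hx⟩,
    Cardinal.mk_iUnion_le_of_le hμ (by simpa using hμ) fun n => hT _, fun m c hc x hx => ?_⟩
  choose n hn using fun i => Set.mem_iUnion.1 (hc i).1
  choose n' hn' using fun i => Set.mem_iUnion.1 (hc i).2
  obtain ⟨N, hN⟩ : ∃ N, ∀ i, max (n i).down (n' i).down ≤ N :=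
    ⟨Finset.univ.sup fun i => max (n i).down (n' i).down,
      fun i => Finset.le_sup (f := fun i => max (n i).down (n' i).down) (Finset.mem_univ i)⟩
  refine Set.mem_iUnion.2 ⟨⟨N + 1⟩, ?_⟩
  change x ∈ T (N + 1)
  rw [hTsucc]
  exact Or.inr (Set.mem_iUnion.2 ⟨⟨m, fun i => (⟨_, hTmono ((le_max_left _ _).trans (hN i)) (hn i)⟩,
    ⟨_, hTmono ((le_max_right _ _).trans (hN i)) (hn' i)⟩)⟩, hx⟩)

end Closure

/-! ### Equational criteria for flatness and for vanishing of tensors -/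

section Witnesses

variable {k : Type u} [Field k] {A B C : CommAlgCat.{u} k}

open scoped TensorProduct

/-- This and its converse express flatness by witnesses for finite relations, a form that descends
to subalgebras closed under a choice of witnesses. -/
theorem RingHom.Flat.exists_of_sum_eq_zero {f : A ⟶ B} (hf : f.hom.toRingHom.Flat) {m : ℕ}
    (a : Fin m → A) (b : Fin m → B) (h : ∑ l, f.hom (a l) * b l = 0) :
    ∃ (p : ℕ) (α : Fin m → Fin p → A) (y : Fin p → B),
      (∀ l, b l = ∑ q, f.hom (α l q) * y q) ∧ ∀ q, ∑ l, a l * α l q = 0 := by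
  let _ := f.hom.toRingHom.toAlgebra
  have : Module.Flat A B := hf
  exact Module.Flat.isTrivialRelation_of_sum_smul_eq_zero (R := A) (M := B) h

theorem RingHom.Flat.of_exists_of_sum_eq_zero {f : A ⟶ B}
    (h : ∀ (m : ℕ) (a : Fin m → A) (b : Fin m → B), ∑ l, f.hom (a l) * b l = 0 →
      ∃ (p : ℕ) (α : Fin m → Fin p → A) (y : Fin p → B),
      (∀ l, b l = ∑ q, f.hom (α l q) * y q) ∧ ∀ q, ∑ l, a l * α l q = 0) :
    f.hom.toRingHom.Flat := by
  let _ := f.hom.toRingHom.toAlgebra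
  exact Module.Flat.of_forall_isTrivialRelation (R := A) (M := B) fun h' => h _ _ _ h'

theorem pushoutAlg.inl_mul_inr (f : A ⟶ B) (g : A ⟶ C) (b : B) (c : C) :
    letI := f.hom.toRingHom.toAlgebra
    letI := g.hom.toRingHom.toAlgebra
    (inl f g).hom b * (inr f g).hom c = (b ⊗ₜ[A] c : B ⊗[A] C) := by
  let _ := f.hom.toRingHom.toAlgebra
  let _ := g.hom.toRingHom.toAlgebra
  have := CommAlgCat.isScalarTower_of_hom f
  change (b ⊗ₜ[A] (1 : C)) * ((1 : B) ⊗ₜ[A] c) = _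
  simp

theorem pushoutAlg.exists_eq_sum (f : A ⟶ B) (g : A ⟶ C) (x : pushoutAlg f g) :
    ∃ (m : ℕ) (b : Fin m → B) (c : Fin m → C),
      x = ∑ l, (inl f g).hom (b l) * (inr f g).hom (c l) := by
  let _ := f.hom.toRingHom.toAlgebra
  let _ := g.hom.toRingHom.toAlgebra
  have := CommAlgCat.isScalarTower_of_hom f
  obtain ⟨S, hS⟩ := TensorProduct.exists_finset (R := A) (M := B) (N := C) x
  refine ⟨S.card, fun l => (S.equivFin.symm l).1.1, fun l => (S.equivFin.symm l).1.2, ?_⟩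
  simp_rw [pushoutAlg.inl_mul_inr]
  refine hS.trans ?_
  rw [← Finset.sum_coe_sort]
  exact (Equiv.sum_comp S.equivFin.symm fun s : S => s.1.1 ⊗ₜ[A] s.1.2).symm

/-- Flatness of `C` embeds the tensor product of `C` with the span of the `b l` into the pushout, so
the tensor already vanishes there, and this gives the equations. -/
theorem pushoutAlg.exists_of_sum_eq_zero (f : A ⟶ B) (g : A ⟶ C) (hg : g.hom.toRingHom.Flat)
    {m : ℕ} (b : Fin m → B) (c : Fin m → C)
    (h : ∑ l, (inl f g).hom (b l) * (inr f g).hom (c l) = 0) :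
    ∃ (p : ℕ) (α : Fin m → Fin p → A) (y : Fin p → C),
      (∀ l, c l = ∑ q, g.hom (α l q) * y q) ∧ ∀ q, ∑ l, f.hom (α l q) * b l = 0 := by
  let _ := f.hom.toRingHom.toAlgebra
  let _ := g.hom.toRingHom.toAlgebra
  have : Module.Flat A C := hg
  refine TensorProduct.vanishesTrivially_of_sum_tmul_eq_zero_of_rTensor_injective A
    (Module.Flat.rTensor_preserves_injective_linearMap _ Subtype.val_injective) ?_
  simp_rw [pushoutAlg.inl_mul_inr] at h
  exact h

theorem pushoutAlg.sum_eq_zero (f : A ⟶ B) (g : A ⟶ C)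
    {m : ℕ} (b : Fin m → B) (c : Fin m → C) {p : ℕ} (α : Fin m → Fin p → A) (y : Fin p → C)
    (h₁ : ∀ l, c l = ∑ q, g.hom (α l q) * y q) (h₂ : ∀ q, ∑ l, f.hom (α l q) * b l = 0) :
    ∑ l, (inl f g).hom (b l) * (inr f g).hom (c l) = 0 := by
  let _ := f.hom.toRingHom.toAlgebra
  let _ := g.hom.toRingHom.toAlgebra
  simp_rw [pushoutAlg.inl_mul_inr]
  exact TensorProduct.sum_tmul_eq_zero_of_vanishesTrivially A ⟨p, α, y, h₁, h₂⟩

/-- Flat homomorphisms form an fpqc family if every proper ideal remains proper in one of the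
targets. -/
theorem isFpqcFamily_of_map_ne_top {ι : Type} {B : ι → CommAlgCat.{u} k} {f : ∀ i, A ⟶ B i}
    (hf : ∀ i, (f i).hom.toRingHom.Flat)
    (h : ∀ m : Ideal A, m.IsMaximal → ∃ i, m.map (f i).hom.toRingHom ≠ ⊤) :
    IsFpqcFamily B f where
  flat := hf
  surj p := by
    obtain ⟨m, hm, hpm⟩ := Ideal.exists_le_maximal p.asIdeal p.2.ne_top
    obtain ⟨i, hi⟩ := h m hm
    obtain ⟨n, hn, hmn⟩ := Ideal.exists_le_maximal _ hi
    have hcomap : PrimeSpectrum.comap (f i).hom.toRingHom ⟨n, hn.isPrime⟩ = ⟨m, hm.isPrime⟩ :=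
      PrimeSpectrum.ext (hm.eq_of_le (Ideal.comap_ne_top _ hn.ne_top)
        (Ideal.map_le_iff_le_comap.1 hmn)).symm
    -- Once a maximal ideal above `p` is in the image, going down for flat homomorphisms reaches
    -- `p`.
    obtain ⟨q, -, hq⟩ := (hf i).generalizingMap_comap (a := ⟨n, hn.isPrime⟩) (b := p) (by
      rw [hcomap]
      exact (PrimeSpectrum.le_iff_specializes _ _).1 hpm)
    exact ⟨i, q, hq⟩

end Witnesses

/-! ### Small fpqc subfamilies by a Löwenheim–Skolem argument -/

section SmallFamilies

open Cardinal

variable {k : Type u} [Field k]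

/-- Every fpqc family contains a small one, which may be chosen to contain given small subsets, and
such that the maps on overlaps are injective. -/
theorem IsFpqcFamily.exists_small {A : CommAlgCat.{u} k} {ι : Type} [Finite ι]
    {B : ι → CommAlgCat.{u} k} {f : ∀ i, A ⟶ B i} (hf : IsFpqcFamily B f) {μ : Cardinal.{u}}
    (hμ : ℵ₀ ≤ μ) (hk : #k ≤ μ) (U : ∀ i, Set (B i)) (hU : ∀ i, #(U i) ≤ μ) :
    ∃ (A' : CommAlgCat.{u} k) (B' : ι → CommAlgCat.{u} k) (f' : ∀ i, A' ⟶ B' i) (g : A' ⟶ A)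
      (h : ∀ i, B' i ⟶ B i) (e : ∀ i, f' i ≫ h i = g ≫ f i), IsFpqcFamily B' f' ∧ #A' ≤ μ ∧
      (∀ i, Function.Injective (h i).hom) ∧ (∀ i, U i ⊆ Set.range (h i).hom) ∧
      ∀ i j, Function.Injective (pushoutAlg.desc (h i ≫ pushoutAlg.inl (f i) (f j))
        (h j ≫ pushoutAlg.inr (f i) (f j)) (by
          rw [← Category.assoc, ← Category.assoc, e, e, Category.assoc, Category.assoc,
            pushoutAlg.condition])).hom := by
  classical
  -- Working in the product lets a single closure process treat `A` and all `B i` together; the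
  -- subalgebras are the projections of the closed set.
  let M : Type u := A × ∀ i, B i
  let inA : A → M := fun a => (a, 0)
  let inB (i : ι) : B i → M := fun b => (0, Pi.single i b)
  -- Four kinds of witnesses: `wit₁` for the ring operations and for `f i` mapping the part in `A`
  -- to the part in `B i`, `wit₂` for flatness, `wit₃` for the unit ideal (joint surjectivity),
  -- `wit₄` for vanishing tensors (injectivity on overlaps).
  have wit₁ (m : ℕ) (c : Fin m → M × M) : ∃ w : Set M, w.Finite ∧ ∀ l,
      (c l).1 + (c l).2 ∈ w ∧ (c l).1 * (c l).2 ∈ w ∧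
        ((c l).1.1, fun i => (f i).hom (c l).1.1) ∈ w :=
    ⟨Set.range (fun l => (c l).1 + (c l).2) ∪ Set.range (fun l => (c l).1 * (c l).2) ∪
      Set.range (fun l => ((c l).1.1, fun i => (f i).hom (c l).1.1)),
      ((Set.finite_range _).union (Set.finite_range _)).union (Set.finite_range _),
      fun l => ⟨Or.inl (Or.inl ⟨l, rfl⟩), Or.inl (Or.inr ⟨l, rfl⟩), Or.inr ⟨l, rfl⟩⟩⟩
  have wit₂ (i : ι) (m : ℕ) (c : Fin m → M × M) : ∃ w : Set M, w.Finite ∧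
      (∑ l, (f i).hom (c l).1.1 * (c l).2.2 i = 0 → ∃ (p : ℕ) (α : Fin m → Fin p → A)
        (y : Fin p → B i), (∀ l q, inA (α l q) ∈ w) ∧ (∀ q, inB i (y q) ∈ w) ∧
        (∀ l, (c l).2.2 i = ∑ q, (f i).hom (α l q) * y q) ∧
        ∀ q, ∑ l, (c l).1.1 * α l q = 0) := by
    by_cases h : ∑ l, (f i).hom (c l).1.1 * (c l).2.2 i = 0
    · obtain ⟨p, α, y, h1, h2⟩ := (hf.flat i).exists_of_sum_eq_zero _ _ h
      exact ⟨Set.range (fun x : Fin m × Fin p => inA (α x.1 x.2)) ∪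
        Set.range (fun q => inB i (y q)), (Set.finite_range _).union (Set.finite_range _),
        fun _ => ⟨p, α, y, fun l q => Or.inl ⟨(l, q), rfl⟩, fun q => Or.inr ⟨q, rfl⟩, h1, h2⟩⟩
    · exact ⟨∅, Set.finite_empty, fun h' => (h h').elim⟩
  have wit₃ (m : ℕ) (c : Fin m → M × M) : ∃ w : Set M, w.Finite ∧
      ((∃ e : Fin m → A, ∑ l, e l * (c l).1.1 = 1) →
        ∃ e : Fin m → A, (∀ l, inA (e l) ∈ w) ∧ ∑ l, e l * (c l).1.1 = 1) := by
    by_cases h : ∃ e : Fin m → A, ∑ l, e l * (c l).1.1 = 1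
    · obtain ⟨e, he⟩ := h
      exact ⟨Set.range fun l => inA (e l), Set.finite_range _, fun _ => ⟨e, fun l => ⟨l, rfl⟩, he⟩⟩
    · exact ⟨∅, Set.finite_empty, fun h' => (h h').elim⟩
  have wit₄ (i j : ι) (m : ℕ) (c : Fin m → M × M) : ∃ w : Set M, w.Finite ∧
      (∑ l, (pushoutAlg.inl (f i) (f j)).hom ((c l).1.2 i) *
          (pushoutAlg.inr (f i) (f j)).hom ((c l).2.2 j) = 0 →
        ∃ (p : ℕ) (α : Fin m → Fin p → A) (y : Fin p → B j), (∀ l q, inA (α l q) ∈ w) ∧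
        (∀ q, inB j (y q) ∈ w) ∧ (∀ l, (c l).2.2 j = ∑ q, (f j).hom (α l q) * y q) ∧
        ∀ q, ∑ l, (f i).hom (α l q) * (c l).1.2 i = 0) := by
    by_cases h : ∑ l, (pushoutAlg.inl (f i) (f j)).hom ((c l).1.2 i) *
          (pushoutAlg.inr (f i) (f j)).hom ((c l).2.2 j) = 0
    · obtain ⟨p, α, y, h1, h2⟩ := pushoutAlg.exists_of_sum_eq_zero _ _ (hf.flat j) _ _ h
      exact ⟨Set.range (fun x : Fin m × Fin p => inA (α x.1 x.2)) ∪
        Set.range (fun q => inB j (y q)), (Set.finite_range _).union (Set.finite_range _),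
        fun _ => ⟨p, α, y, fun l q => Or.inl ⟨(l, q), rfl⟩, fun q => Or.inr ⟨q, rfl⟩, h1, h2⟩⟩
    · exact ⟨∅, Set.finite_empty, fun h' => (h h').elim⟩
  choose w₁ hw₁ hw₁' using wit₁
  choose w₂ hw₂ hw₂' using wit₂
  choose w₃ hw₃ hw₃' using wit₃
  choose w₄ hw₄ hw₄' using wit₄
  let W (m : ℕ) (c : Fin m → M × M) : Set M :=
    w₁ m c ∪ (⋃ i, w₂ i m c) ∪ w₃ m c ∪ ⋃ i, ⋃ j, w₄ i j m c
  have hW (m : ℕ) (c : Fin m → M × M) : #(W m c) ≤ μ := by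
    have : (W m c).Finite := (((hw₁ m c).union (Set.finite_iUnion fun i => hw₂ i m c)).union
      (hw₃ m c)).union (Set.finite_iUnion fun i => Set.finite_iUnion fun j => hw₄ i j m c)
    exact (Cardinal.lt_aleph0_iff_set_finite.2 this).le.trans hμ
  obtain ⟨T, hUT, hT, hclosed⟩ := Set.exists_closed_superset hμ W hW
    (Set.range (algebraMap k M) ∪ ⋃ i : ULift.{u} ι, inB i.down '' U i.down)
    ((Cardinal.mk_union_le _ _).trans (Cardinal.add_le_of_le hμ (Cardinal.mk_range_le.trans hk)
      (Cardinal.mk_iUnion_le_of_le hμ ((Cardinal.lt_aleph0_of_finite _).le.trans hμ)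
        fun i => Cardinal.mk_image_le.trans (hU _))))
  have mem₁ {x y : M} (hx : x ∈ T) (hy : y ∈ T) : x + y ∈ T ∧ x * y ∈ T ∧
      (x.1, fun i => (f i).hom x.1) ∈ T := by
    have h1 := hw₁' 1 (fun _ => (x, y)) 0
    have h2 : w₁ 1 (fun _ => (x, y)) ⊆ T := fun z hz =>
      hclosed 1 (fun _ => (x, y)) (fun _ => ⟨hx, hy⟩) (Or.inl (Or.inl (Or.inl hz)))
    exact ⟨h2 h1.1, h2 h1.2.1, h2 h1.2.2⟩
  let R : Subalgebra k M :=
    { carrier := T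
      mul_mem' := fun hx hy => (mem₁ hx hy).2.1
      add_mem' := fun hx hy => (mem₁ hx hy).1
      algebraMap_mem' := fun r => hUT (Or.inl ⟨r, rfl⟩) }
  let S : Subalgebra k A := R.map (AlgHom.fst k A (∀ i, B i))
  let prB (i : ι) : M →ₐ[k] B i :=
    (Pi.evalAlgHom k (fun i => (B i : Type u)) i).comp (AlgHom.snd k A (∀ i, B i))
  let T' (i : ι) : Subalgebra k (B i) := R.map (prB i)
  have hS : #S ≤ μ := Cardinal.mk_image_le.trans hT
  have inA_mem {a : A} (h : inA a ∈ T) : a ∈ S := ⟨_, h, rfl⟩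
  have inB_mem {i : ι} {b : B i} (h : inB i b ∈ T) : b ∈ T' i := ⟨_, h,
    Pi.single_eq_same (M := fun i => (B i : Type u)) i b⟩
  have hfS (i : ι) (a : S) : (f i).hom a.1 ∈ T' i := by
    obtain ⟨x, hx, hxa⟩ := a.2
    rw [← hxa]
    exact ⟨_, (mem₁ hx hx).2.2, rfl⟩
  let f' (i : ι) : CommAlgCat.of k S ⟶ CommAlgCat.of k (T' i) :=
    CommAlgCat.ofHom (((f i).hom.comp S.val).codRestrict (T' i) (hfS i))
  let g : CommAlgCat.of k S ⟶ A := CommAlgCat.ofHom S.val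
  let h (i : ι) : CommAlgCat.of k (T' i) ⟶ B i := CommAlgCat.ofHom (T' i).val
  have hflat (i : ι) : (f' i).hom.toRingHom.Flat := by
    refine RingHom.Flat.of_exists_of_sum_eq_zero fun m a b hab => ?_
    choose x hx hxa using fun l => (a l).2
    choose y hy hyb using fun l => (b l).2
    have hsub : w₂ i m (fun l => (x l, y l)) ⊆ T := fun z hz =>
      hclosed m _ (fun l => ⟨hx l, hy l⟩) (Or.inl (Or.inl (Or.inr (Set.mem_iUnion.2 ⟨i, hz⟩))))
    obtain ⟨p, α, v, hα, hv, h1, h2⟩ := hw₂' i m (fun l => (x l, y l)) (by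
      have hab' := congrArg (T' i).val hab
      rw [map_sum, map_zero] at hab'
      refine (Finset.sum_congr rfl fun l _ => ?_).trans hab'
      change _ = (f i).hom (a l).1 * (b l).1
      rw [← hxa, ← hyb]
      rfl)
    refine ⟨p, fun l q => ⟨α l q, inA_mem (hsub (hα l q))⟩, fun q => ⟨v q, inB_mem (hsub (hv q))⟩,
      fun l => Subtype.ext ?_, fun q => Subtype.ext ?_⟩
    · exact (hyb l).symm.trans ((h1 l).trans
        (map_sum (T' i).val (fun q => (f' i).hom (⟨α l q, inA_mem (hsub (hα l q))⟩ : S) *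
          (⟨v q, inB_mem (hsub (hv q))⟩ : T' i)) Finset.univ).symm)
    · refine (map_sum S.val _ _).trans ((Finset.sum_congr rfl fun l _ => ?_).trans (h2 q))
      change (a l).1 * α l q = _
      rw [← hxa]
      rfl
  refine ⟨CommAlgCat.of k S, fun i => CommAlgCat.of k (T' i), f', g, h, fun i => rfl,
    isFpqcFamily_of_map_ne_top hflat fun m hm => ?_, hS, fun i => Subtype.val_injective,
    fun i b hb => ?_, fun i j => ?_⟩
  · by_contra! hcon
    -- If `m` generated a proper ideal of `A`, a maximal ideal above it would be the image of a
    -- point of some `B i`, although `m` generates the unit ideal there.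
    have hA : m.map g.hom.toRingHom = ⊤ := by
      by_contra hne
      obtain ⟨n, hn, hmn⟩ := Ideal.exists_le_maximal _ hne
      obtain ⟨i, q, hq⟩ := hf.surj ⟨n, hn.isPrime⟩
      refine q.2.ne_top (top_le_iff.1 ?_)
      have h1 : (m.map (f' i).hom.toRingHom).map (h i).hom.toRingHom = ⊤ := by
        rw [hcon i, Ideal.map_top]
      have h2 : (m.map g.hom.toRingHom).map (f i).hom.toRingHom = ⊤ := by
        rw [← h1, Ideal.map_map, Ideal.map_map]
        rfl
      rw [← h2, Ideal.map_le_iff_le_comap]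
      exact hmn.trans (congrArg PrimeSpectrum.asIdeal hq).ge
    obtain ⟨n, e, v, hev⟩ := Submodule.mem_span_set'.1 ((Ideal.eq_top_iff_one _).1 hA)
    choose a ha hav using fun l => (v l).2
    choose x hx hxa using fun l => (a l).2
    have hxv (l) : (x l).1 = (v l).1 := (hxa l).trans (hav l)
    -- The coefficients of the relation `1 = ∑ e v` lie in `A`; the chosen witnesses replace them by
    -- coefficients in `S`. Only first entries of the pairs matter, so they are doubled.
    obtain ⟨e', he', hsum⟩ := hw₃' n (fun l => (x l, x l)) ⟨e, by simpa only [hxv, smul_eq_mul] using hev⟩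
    have hsub : w₃ n (fun l => (x l, x l)) ⊆ T := fun z hz =>
      hclosed n _ (fun l => ⟨hx l, hx l⟩) (Or.inl (Or.inr hz))
    refine hm.ne_top ((Ideal.eq_top_iff_one _).2 ?_)
    have hone : ∑ l, (⟨e' l, inA_mem (hsub (he' l))⟩ : S) * a l = 1 :=
      Subtype.ext ((map_sum S.val _ _).trans (((Finset.sum_congr rfl fun l _ =>
        congrArg (e' l * ·) (hxa l).symm)).trans hsum))
    rw [← hone]
    exact Ideal.sum_mem _ fun l _ => Ideal.mul_mem_left _ _ (ha l)
  · exact ⟨⟨b, inB_mem (hUT (Or.inr (Set.mem_iUnion.2 ⟨⟨i⟩, b, hb, rfl⟩)))⟩, rfl⟩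
  · rw [injective_iff_map_eq_zero]
    intro z hz
    obtain ⟨m, b, c, rfl⟩ := pushoutAlg.exists_eq_sum _ _ z
    choose x hx hxb using fun l => (b l).2
    choose y hy hyc using fun l => (c l).2
    have hsub : w₄ i j m (fun l => (x l, y l)) ⊆ T := fun z hz =>
      hclosed m _ (fun l => ⟨hx l, hy l⟩)
        (Or.inr (Set.mem_iUnion.2 ⟨i, Set.mem_iUnion.2 ⟨j, hz⟩⟩))
    obtain ⟨p, α, v, hα, hv, h1, h2⟩ := hw₄' i j m (fun l => (x l, y l)) (by
      rw [map_sum] at hz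
      refine (Finset.sum_congr rfl fun l _ => ?_).trans hz
      rw [map_mul]
      have e₁ := congrArg (fun φ : CommAlgCat.of k (T' i) ⟶ _ => φ.hom (b l))
        (pushoutAlg.inl_desc (f := f' i) (g := f' j) (h i ≫ pushoutAlg.inl (f i) (f j))
          (h j ≫ pushoutAlg.inr (f i) (f j)) (by
            change g ≫ f i ≫ _ = g ≫ f j ≫ _
            rw [pushoutAlg.condition]))
      have e₂ := congrArg (fun φ : CommAlgCat.of k (T' j) ⟶ _ => φ.hom (c l))
        (pushoutAlg.inr_desc (f := f' i) (g := f' j) (h i ≫ pushoutAlg.inl (f i) (f j))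
          (h j ≫ pushoutAlg.inr (f i) (f j)) (by
            change g ≫ f i ≫ _ = g ≫ f j ≫ _
            rw [pushoutAlg.condition]))
      refine Eq.symm ((congrArg₂ (· * ·) e₁ e₂).trans ?_)
      change (pushoutAlg.inl (f i) (f j)).hom (b l).1 * (pushoutAlg.inr (f i) (f j)).hom (c l).1 = _
      rw [← hxb, ← hyc]
      rfl)
    refine pushoutAlg.sum_eq_zero _ _ _ _ (fun l q => (⟨α l q, inA_mem (hsub (hα l q))⟩ : S))
      (fun q => ⟨v q, inB_mem (hsub (hv q))⟩) (fun l => Subtype.ext ?_) fun q => Subtype.ext ?_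
    · exact (hyc l).symm.trans ((h1 l).trans
        (map_sum (T' j).val (fun q => (f' j).hom (⟨α l q, inA_mem (hsub (hα l q))⟩ : S) *
          (⟨v q, inB_mem (hsub (hv q))⟩ : T' j)) Finset.univ).symm)
    · refine (map_sum (T' i).val _ _).trans ((Finset.sum_congr rfl fun l _ => ?_).trans (h2 q))
      change (f i).hom (α l q) * (b l).1 = _
      rw [← hxb]
      rfl

end SmallFamilies

/-! ### Connected components: injections and filtered colimits -/

section PiZero

variable {k : Type u} [Field k]

theorem PrimeSpectrum.mem_iff_of_connectedComponents_eq {R : Type*} [CommRing R] {e : R}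
    (he : IsIdempotentElem e) {p q : PrimeSpectrum R}
    (h : (p : _root_.ConnectedComponents (PrimeSpectrum R)) = q) :
    e ∈ p.asIdeal ↔ e ∈ q.asIdeal := by
  have key : ∀ {p q : PrimeSpectrum R}, (p : _root_.ConnectedComponents (PrimeSpectrum R)) = q →
      e ∈ q.asIdeal → e ∈ p.asIdeal := by
    intro p q h hq
    by_contra hp
    have hcl : IsClopen (PrimeSpectrum.basicOpen e : Set (PrimeSpectrum R)) :=
      PrimeSpectrum.isClopen_iff.2 ⟨e, he, rfl⟩
    exact hcl.connectedComponent_subset (x := p) hp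
      (ConnectedComponents.coe_eq_coe'.1 h.symm) hq
  exact ⟨key h.symm, key h⟩

/-- Clopen subsets of the space of components of the spectrum are given by idempotents. -/
theorem PrimeSpectrum.exists_isIdempotentElem_of_isClopen {R : Type*} [CommRing R]
    {U : Set (_root_.ConnectedComponents (PrimeSpectrum R))} (hU : IsClopen U) :
    ∃ e : R, IsIdempotentElem e ∧ ∀ p : PrimeSpectrum R,
      (p : _root_.ConnectedComponents (PrimeSpectrum R)) ∈ U ↔ e ∉ p.asIdeal := by
  obtain ⟨e, he, h⟩ := PrimeSpectrum.isClopen_iff.1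
    (hU.preimage (f := ((↑) : PrimeSpectrum R → _)) ConnectedComponents.continuous_coe)
  exact ⟨e, he, fun p => Set.ext_iff.1 h p⟩

/-- Every component contains a minimal prime, and minimal primes lift along injective homomorphisms.
-/
theorem piZeroSpecFunctor_map_surjective {A B : CommAlgCat.{u} k} (f : A ⟶ B)
    (hf : Function.Injective f.hom) :
    Function.Surjective ((piZeroSpecFunctor k).map f).unop := by
  intro c
  obtain ⟨p, rfl⟩ := ConnectedComponents.surjective_coe c
  obtain ⟨q, hq, hqp⟩ := Ideal.exists_minimalPrimes_le (bot_le : ⊥ ≤ p.asIdeal)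
  obtain ⟨r, hr, hrq⟩ := Ideal.exists_comap_eq_of_mem_minimalPrimes_of_injective
    (f := f.hom.toRingHom) hf q hq
  refine ⟨((⟨r, hr⟩ : PrimeSpectrum B) : _root_.ConnectedComponents (PrimeSpectrum B)), ?_⟩
  have hq' : q.IsPrime := hq.1.1
  have hspec : (⟨q, hq'⟩ : PrimeSpectrum A) ⤳ p := (PrimeSpectrum.le_iff_specializes _ _).1 hqp
  have h1 : PrimeSpectrum.comap f.hom.toRingHom ⟨r, hr⟩ = ⟨q, hq'⟩ := PrimeSpectrum.ext hrq
  change ((PrimeSpectrum.comap f.hom.toRingHom ⟨r, hr⟩ : PrimeSpectrum A) :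
    _root_.ConnectedComponents (PrimeSpectrum A)) = p
  rw [h1, ConnectedComponents.coe_eq_coe']
  exact (isPreconnected_singleton.closure).subset_connectedComponent hspec.mem_closure
    (subset_closure rfl)

theorem IsCondensedSet.injective_piZeroPresheaf_map {X : Profinite.{u}ᵒᵖ ⥤ Type u}
    (hX : IsCondensedSet X) {A B : CommAlgCat.{u} k} (f : A ⟶ B) (hf : Function.Injective f.hom) :
    Function.Injective ((piZeroPresheaf k X).map f) :=
  hX.injective_map _ (piZeroSpecFunctor_map_surjective f hf)

open Limits

theorem CommAlgCat.exists_isIdempotentElem_of_isColimit {J : Type u} [SmallCategory J]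
    [IsFiltered J] {K : J ⥤ CommAlgCat.{u} k} {c : Cocone K} (hc : IsColimit c) {e : c.pt}
    (he : IsIdempotentElem e) :
    ∃ (j : J) (a : K.obj j), IsIdempotentElem a ∧ (c.ι.app j).hom a = e := by
  obtain ⟨j, a, rfl⟩ := CommAlgCat.exists_rep_of_isColimit hc e
  obtain ⟨i, f, hf⟩ := CommAlgCat.exists_eq_of_isColimit hc (x := a * a) (y := a)
    ((map_mul _ _ _).trans he)
  refine ⟨i, (K.map f).hom a, (map_mul _ _ _).symm.trans hf, ?_⟩
  exact congrArg (fun φ : K.obj j ⟶ c.pt => φ.hom a) (c.w f)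

instance piZeroSpecFunctor_preservesColimitsOfShape {J : Type u} [SmallCategory J] [IsFiltered J] :
    PreservesColimitsOfShape J (piZeroSpecFunctor k) := by
  refine ⟨fun {K} => ⟨fun {c} hc => ?_⟩⟩
  let K' := K ⋙ piZeroSpecFunctor k
  let D := (piZeroSpecFunctor k).mapCocone c
  let T : Profinite.{u} := (colimit K').unop
  let pr (j : J) : T ⟶ piZeroSpec (K.obj j) := (colimit.ι K' j).unop
  let d : piZeroSpec c.pt ⟶ T := (colimit.desc K' D).unop
  have hd (j : J) (x) : pr j (d x) = ((piZeroSpecFunctor k).map (c.ι.app j)).unop x :=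
    congrArg (fun φ : K'.obj j ⟶ D.pt => φ.unop x) (colimit.ι_desc D j)
  have hpr {i j : J} (f : i ⟶ j) (t : T) :
      ((piZeroSpecFunctor k).map (K.map f)).unop (pr j t) = pr i t :=
    congrArg (fun φ : K'.obj i ⟶ colimit K' => φ.unop t) (colimit.w K' f)
  -- Distinct components are separated by an idempotent of the colimit, which comes from an
  -- idempotent at some stage.
  have hinj : Function.Injective d := by
    intro x y hxy
    by_contra hne
    obtain ⟨U, hU, hxU, hyU⟩ := exists_isClopen_of_totally_separated hne
    obtain ⟨e, he, heU⟩ := PrimeSpectrum.exists_isIdempotentElem_of_isClopen hU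
    obtain ⟨p, rfl⟩ := ConnectedComponents.surjective_coe x
    obtain ⟨q, rfl⟩ := ConnectedComponents.surjective_coe y
    obtain ⟨j, a, ha, rfl⟩ := CommAlgCat.exists_isIdempotentElem_of_isColimit hc he
    have h := (hd j _).symm.trans ((congrArg (pr j) hxy).trans (hd j _))
    have h1 := PrimeSpectrum.mem_iff_of_connectedComponents_eq
      (p := PrimeSpectrum.comap (c.ι.app j).hom.toRingHom p)
      (q := PrimeSpectrum.comap (c.ι.app j).hom.toRingHom q) ha h
    exact (heU p).1 hxU (h1.2 (not_not.1 fun hq => hyU ((heU q).2 hq)))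
  -- A point `t` outside the closed image has a clopen neighbourhood missing the image and defined
  -- by an idempotent at some stage. That idempotent lies in every prime of the colimit, so it
  -- vanishes there and hence at a later stage, contradicting the existence of `t`.
  have hsurj : Function.Surjective d := by
    intro t
    by_contra ht
    have hcl : IsClosed (Set.range d) := (isCompact_range d.hom.hom.continuous).isClosed
    obtain ⟨U, hU, htU, hUd⟩ := compact_exists_isClopen_in_isOpen hcl.isOpen_compl ht
    obtain ⟨j, V, hV, hUV⟩ := Profinite.exists_isClopen_of_cofiltered
      (coneLeftOpOfCocone (colimit.cocone K')) (isLimitConeLeftOpOfCocone _ (colimit.isColimit K')) hU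
    obtain ⟨a, ha, haV⟩ := PrimeSpectrum.exists_isIdempotentElem_of_isClopen hV
    have hUV' (x : T) : x ∈ U ↔ pr j.unop x ∈ V := Set.ext_iff.1 hUV x
    have h0 : (c.ι.app j.unop).hom a = 0 := by
      have hnil : IsNilpotent ((c.ι.app j.unop).hom a) := by
        rw [nilpotent_iff_mem_prime]
        intro p hp
        by_contra hap
        refine hUd ((hUV' (d ((⟨p, hp⟩ : PrimeSpectrum c.pt) :
          _root_.ConnectedComponents (PrimeSpectrum c.pt)))).2 ?_) ⟨_, rfl⟩
        exact (congrArg (· ∈ V) (hd j.unop _)).mpr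
          ((haV (PrimeSpectrum.comap (c.ι.app j.unop).hom.toRingHom ⟨p, hp⟩)).2 hap)
      obtain ⟨n, hn⟩ := hnil
      have ha' : IsIdempotentElem ((c.ι.app j.unop).hom a) := ha.map _
      rw [← ha'.pow_succ_eq n, pow_succ, hn, zero_mul]
    obtain ⟨i, f, hf⟩ := CommAlgCat.exists_eq_of_isColimit hc (x := a) (y := 0)
      (h0.trans (map_zero _).symm)
    obtain ⟨q, hq⟩ := ConnectedComponents.surjective_coe (pr i t)
    have h1 := (hUV' t).1 htU
    rw [← hpr f, ← hq] at h1
    refine (haV (PrimeSpectrum.comap (K.map f).hom.toRingHom q)).1 h1 ?_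
    change (K.map f).hom a ∈ q.asIdeal
    rw [hf, map_zero]
    exact q.asIdeal.zero_mem
  have : IsIso d := CompHausLike.isIso_of_bijective d ⟨hinj, hsurj⟩
  have : IsIso ((colimit.isColimit K').desc D) := by
    have h : IsIso (colimit.desc K' D).unop := this
    exact (isIso_unop_iff _).1 h
  exact ⟨IsColimit.ofPointIso (colimit.isColimit K')⟩

instance isCardinalAccessible_piZeroSpecFunctor (κ : Cardinal.{u}) [Fact κ.IsRegular] :
    (piZeroSpecFunctor k).IsCardinalAccessible κ where
  preservesColimitOfShape J _ _ := by
    have := isFiltered_of_isCardinalFiltered J κ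
    infer_instance

end PiZero

/-! ### The adjunction between continuous functions and components of spectra -/

section Counit

variable {k : Type u} [Field k]

/-- The element `a` is locally on the spectrum given by the constants `h p`. -/
def IsLocallyConst {R : Type*} [CommRing R] [Algebra k R] (a : R) (h : PrimeSpectrum R → k) :
    Prop :=
  ∀ p : PrimeSpectrum R, ∃ s, s ∉ p.asIdeal ∧ s * (a - algebraMap k R (h p)) = 0

namespace IsLocallyConst

variable {R : Type*} [CommRing R] [Algebra k R] {a b : R} {h h' : PrimeSpectrum R → k}

/-- Otherwise the annihilator of `a - b` lies in a maximal ideal, but it contains a product of two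
elements outside that ideal. This uniqueness reduces identities between elements to identities
between their local values. -/
theorem eq (ha : IsLocallyConst a h) (hb : IsLocallyConst b h) : a = b := by
  by_contra hne
  have htop : Ideal.span {a - b} ≠ ⊥ := by
    rw [Ne, Ideal.span_singleton_eq_bot, sub_eq_zero]
    exact hne
  have hann : (Ideal.span {a - b}).annihilator ≠ ⊤ := by
    rwa [Ne, Submodule.annihilator_eq_top_iff]
  obtain ⟨m, hm, hle⟩ := Ideal.exists_le_maximal _ hann
  obtain ⟨s, hs, hsa⟩ := ha ⟨m, hm.isPrime⟩
  obtain ⟨t, ht, htb⟩ := hb ⟨m, hm.isPrime⟩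
  have hst : s * t ∈ m := by
    refine hle (Submodule.mem_annihilator_span_singleton _ _ |>.2 ?_)
    rw [smul_eq_mul]
    linear_combination t * hsa - s * htb
  exact (hm.isPrime.mem_or_mem hst).elim hs ht

theorem add (ha : IsLocallyConst a h) (hb : IsLocallyConst b h') :
    IsLocallyConst (a + b) (h + h') := by
  intro p
  obtain ⟨s, hs, hsa⟩ := ha p
  obtain ⟨t, ht, htb⟩ := hb p
  refine ⟨s * t, fun hst => (p.isPrime.mem_or_mem hst).elim hs ht, ?_⟩
  rw [Pi.add_apply, map_add]
  linear_combination t * hsa + s * htb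

theorem mul (ha : IsLocallyConst a h) (hb : IsLocallyConst b h') :
    IsLocallyConst (a * b) (h * h') := by
  intro p
  obtain ⟨s, hs, hsa⟩ := ha p
  obtain ⟨t, ht, htb⟩ := hb p
  refine ⟨s * t, fun hst => (p.isPrime.mem_or_mem hst).elim hs ht, ?_⟩
  rw [Pi.mul_apply, map_mul]
  linear_combination t * b * hsa + s * algebraMap k R (h p) * htb

theorem const (c : k) : IsLocallyConst (algebraMap k R c) (fun _ => c) := fun p =>
  ⟨1, p.isPrime.one_notMem, by simp⟩

theorem sum {α : Type*} (s : Finset α) {a : α → R} {h : α → PrimeSpectrum R → k}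
    (ha : ∀ i, IsLocallyConst (a i) (h i)) : IsLocallyConst (∑ i ∈ s, a i) (∑ i ∈ s, h i) := by
  classical
  induction s using Finset.induction_on with
  | empty => exact fun p => ⟨1, p.isPrime.one_notMem, by simp⟩
  | insert i s hi ih =>
    rw [Finset.sum_insert hi, Finset.sum_insert hi]
    exact (ha i).add ih

open scoped Classical in
theorem of_isIdempotentElem (he : IsIdempotentElem a) :
    IsLocallyConst a (fun p => if a ∈ p.asIdeal then (0 : k) else 1) := by
  intro p
  by_cases hp : a ∈ p.asIdeal
  · refine ⟨1 - a, fun h => p.isPrime.one_notMem (by simpa using p.asIdeal.add_mem h hp), ?_⟩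
    simp only [hp, if_true, map_zero]
    linear_combination -he.eq
  · refine ⟨a, hp, ?_⟩
    simp only [hp, if_false, map_one]
    linear_combination he.eq

theorem map {R' : Type*} [CommRing R'] [Algebra k R'] (f : R →ₐ[k] R') (ha : IsLocallyConst a h) :
    IsLocallyConst (f a) (fun q => h (PrimeSpectrum.comap f.toRingHom q)) := by
  intro q
  obtain ⟨s, hs, hsa⟩ := ha (PrimeSpectrum.comap f.toRingHom q)
  exact ⟨f s, hs, by simpa using congrArg f hsa⟩

theorem mem_iff (ha : IsLocallyConst a h) (p : PrimeSpectrum R) : a ∈ p.asIdeal ↔ h p = 0 := by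
  obtain ⟨s, hs, hsa⟩ := ha p
  have hmem : a - algebraMap k R (h p) ∈ p.asIdeal :=
    (p.isPrime.mem_or_mem (hsa ▸ p.asIdeal.zero_mem)).resolve_left hs
  constructor
  · intro hap
    by_contra h0
    have h1 : algebraMap k R (h p) ∈ p.asIdeal := by
      simpa using p.asIdeal.sub_mem hap hmem
    exact p.isPrime.ne_top (Ideal.eq_top_of_isUnit_mem _ h1 ((Ne.isUnit h0).map _))
  · intro h0
    simpa [h0] using hmem

/-- The fibres of `h` are clopen, so they are given by idempotents `e c`; the element is the finite
sum of the `c * e c`. -/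
theorem exists_of_locallyConstant
    (h : LocallyConstant (_root_.ConnectedComponents (PrimeSpectrum R)) k) :
    ∃ a : R, IsLocallyConst a (fun p => h p) := by
  classical
  choose e he hmem using fun c : k => PrimeSpectrum.exists_isIdempotentElem_of_isClopen (R := R)
    (h.isLocallyConstant.isClopen_fiber c)
  refine ⟨∑ c ∈ h.range_finite.toFinset, algebraMap k R c * e c, ?_⟩
  have := IsLocallyConst.sum h.range_finite.toFinset fun c =>
    (const (R := R) c).mul (of_isIdempotentElem (k := k) (he c))
  convert this using 1
  funext p
  have hite (c : k) : (if e c ∈ p.asIdeal then (0 : k) else 1) = if h p = c then 1 else 0 := by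
    have : h p = c ↔ e c ∉ p.asIdeal := hmem c p
    by_cases hp : e c ∈ p.asIdeal
    · rw [if_pos hp, if_neg fun hc => this.1 hc hp]
    · rw [if_neg hp, if_pos (this.2 hp)]
  simp [Finset.sum_apply, hite]

end IsLocallyConst

/-- The ring homomorphism that evaluates locally constant functions on the space of components of
the spectrum. -/
noncomputable def locallyConstantToAlg (A : CommAlgCat.{u} k) :
    LocallyConstant (_root_.ConnectedComponents (PrimeSpectrum A)) k →ₐ[k] A :=
  AlgHom.mk'
    { toFun h := (IsLocallyConst.exists_of_locallyConstant h).choose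
      map_one' := (IsLocallyConst.exists_of_locallyConstant _).choose_spec.eq
        (by simpa using IsLocallyConst.const (R := A) (1 : k))
      map_zero' := (IsLocallyConst.exists_of_locallyConstant _).choose_spec.eq
        (by simpa using IsLocallyConst.const (R := A) (0 : k))
      map_mul' h h' := (IsLocallyConst.exists_of_locallyConstant _).choose_spec.eq
        ((IsLocallyConst.exists_of_locallyConstant h).choose_spec.mul
          (IsLocallyConst.exists_of_locallyConstant h').choose_spec)
      map_add' h h' := (IsLocallyConst.exists_of_locallyConstant _).choose_spec.eq
        ((IsLocallyConst.exists_of_locallyConstant h).choose_spec.add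
          (IsLocallyConst.exists_of_locallyConstant h').choose_spec) }
    fun c h => (IsLocallyConst.exists_of_locallyConstant _).choose_spec.eq (by
      have := (IsLocallyConst.const (R := A) c).mul
        (IsLocallyConst.exists_of_locallyConstant h).choose_spec
      rw [Algebra.smul_def]
      exact this)

theorem isLocallyConst_locallyConstantToAlg (A : CommAlgCat.{u} k)
    (h : LocallyConstant (_root_.ConnectedComponents (PrimeSpectrum A)) k) :
    IsLocallyConst (locallyConstantToAlg A h) (fun p => h p) :=
  (IsLocallyConst.exists_of_locallyConstant h).choose_spec

variable (k)

/-- Points of `S` are separated by characteristic functions of clopen sets, which are idempotents.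
The image is closed, and an idempotent defining a clopen set disjoint from it vanishes at every
point of `S`, so it is zero. -/
theorem toPiZeroSpec_bijective (S : Profinite.{u}) : Function.Bijective (toPiZeroSpec k S) := by
  classical
  constructor
  · intro s t hst
    by_contra hne
    obtain ⟨U, hU, hs, ht⟩ := exists_isClopen_of_totally_separated hne
    have he : IsIdempotentElem (LocallyConstant.charFn k hU) := by
      ext x
      by_cases hx : x ∈ U <;> simp [LocallyConstant.charFn, hx]
    have := PrimeSpectrum.mem_iff_of_connectedComponents_eq
      (R := LocallyConstant S k) (p := evalPoint k S s) (q := evalPoint k S t) he hst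
    have h1 : LocallyConstant.charFn k hU s = 0 :=
      this.2 (show LocallyConstant.charFn k hU t = 0 from (LocallyConstant.charFn_eq_zero _ _ hU).2 ht)
    exact (LocallyConstant.charFn_eq_zero _ _ hU).1 h1 hs
  · intro c
    by_contra hc
    have hcl : IsClosed (Set.range (toPiZeroSpec k S)) :=
      (isCompact_range (toPiZeroSpec k S).hom.hom.continuous).isClosed
    obtain ⟨U, hU, hcU, hUd⟩ := compact_exists_isClopen_in_isOpen hcl.isOpen_compl hc
    obtain ⟨e, he, heU⟩ := PrimeSpectrum.exists_isIdempotentElem_of_isClopen hU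
    have h0 : (show LocallyConstant S k from e) = 0 := by
      ext s
      by_contra hs
      exact hUd ((heU (evalPoint k S s)).2 hs) ⟨s, rfl⟩
    obtain ⟨q, rfl⟩ := ConnectedComponents.surjective_coe c
    exact (heU q).1 hcU ((congrArg (· ∈ q.asIdeal) h0).mpr q.asIdeal.zero_mem)

/-- The inverse of `toPiZeroSpec`. -/
noncomputable def ofPiZeroSpec (S : Profinite.{u}) :
    piZeroSpec ((continuousFunctions k).obj (op S)) ⟶ S :=
  have : IsIso (toPiZeroSpec k S) := CompHausLike.isIso_of_bijective _ (toPiZeroSpec_bijective k S)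
  inv (toPiZeroSpec k S)

theorem toPiZeroSpec_comp_ofPiZeroSpec (S : Profinite.{u}) :
    toPiZeroSpec k S ≫ ofPiZeroSpec k S = 𝟙 S :=
  have : IsIso (toPiZeroSpec k S) := CompHausLike.isIso_of_bijective _ (toPiZeroSpec_bijective k S)
  IsIso.hom_inv_id _

theorem ofPiZeroSpec_toPiZeroSpec (S : Profinite.{u}) (s : S) :
    ofPiZeroSpec k S (toPiZeroSpec k S s) = s :=
  congrArg (fun φ : S ⟶ S => φ s) (toPiZeroSpec_comp_ofPiZeroSpec k S)

/-- Near the component of `s`, the characteristic function of the fibre of `f` through `s`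
annihilates `f - f s`. This yields the first triangle identity. -/
theorem isLocallyConst_continuousFunctions (S : Profinite.{u}) (f : LocallyConstant S k)
    (h : PrimeSpectrum ((continuousFunctions k).obj (op S)) → k)
    (hf : ∀ p s, toPiZeroSpec k S s = ConnectedComponents.mk p →
      h p = f s) :
    IsLocallyConst (R := (continuousFunctions k).obj (op S)) f h := by
  intro p
  obtain ⟨s, hs⟩ := (toPiZeroSpec_bijective k S).2 (ConnectedComponents.mk p)
  have hU : IsClopen {t | f t = f s} := f.isLocallyConstant.isClopen_fiber (f s)
  have he : IsIdempotentElem (LocallyConstant.charFn k hU) := by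
    ext x
    by_cases hx : f x = f s <;> simp [LocallyConstant.charFn, hx]
  have hmem := PrimeSpectrum.mem_iff_of_connectedComponents_eq
    (R := LocallyConstant S k) (p := evalPoint k S s) (q := p) he hs
  refine ⟨LocallyConstant.charFn k hU, fun hp => (LocallyConstant.charFn_eq_zero _ _ hU).1
    (hmem.2 hp) rfl, ?_⟩
  rw [hf p s hs]
  refine LocallyConstant.ext fun x => ?_
  change LocallyConstant.charFn k hU x * (f x - f s) = 0
  by_cases hx : f x = f s <;> simp [LocallyConstant.charFn, hx]

/-- `C(-, k)` is left adjoint to `π₀|Spec -|`. -/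
noncomputable def continuousFunctionsAdj : continuousFunctions k ⊣ piZeroSpecFunctor k :=
  Adjunction.mkOfUnitCounit
    { unit :=
        { app S := (ofPiZeroSpec k S.unop).op
          naturality S T f := by
            apply Quiver.Hom.unop_inj
            ext c
            obtain ⟨t, rfl⟩ := (toPiZeroSpec_bijective k T.unop).2 c
            change f.unop (ofPiZeroSpec k T.unop (toPiZeroSpec k T.unop t)) =
              ofPiZeroSpec k S.unop (toPiZeroSpec k S.unop (f.unop t))
            rw [ofPiZeroSpec_toPiZeroSpec, ofPiZeroSpec_toPiZeroSpec] }
      counit :=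
        { app A := CommAlgCat.ofHom (locallyConstantToAlg A)
          naturality A B f := by
            ext h
            exact (isLocallyConst_locallyConstantToAlg B _).eq
              ((isLocallyConst_locallyConstantToAlg A h).map f.hom) }
      left_triangle := by
        ext S f
        refine (isLocallyConst_locallyConstantToAlg ((continuousFunctions k).obj S) _).eq
          (isLocallyConst_continuousFunctions k S.unop f _ fun p s hp => ?_)
        change (show LocallyConstant S.unop k from f) (ofPiZeroSpec k S.unop
          (ConnectedComponents.mk p)) = (show LocallyConstant S.unop k from f) s
        exact congrArg (show LocallyConstant S.unop k from f)
          ((congrArg (ofPiZeroSpec k S.unop) hp.symm).trans (ofPiZeroSpec_toPiZeroSpec k S.unop s))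
      right_triangle := by
        ext A
        apply Quiver.Hom.unop_inj
        ext c
        obtain ⟨p, rfl⟩ := ConnectedComponents.surjective_coe c
        -- The element of `A` attached to a locally constant function lies in `p` exactly when the
        -- function vanishes at the component of `p`.
        have h : PrimeSpectrum.comap (locallyConstantToAlg A).toRingHom p =
            evalPoint k (piZeroSpec A) (ConnectedComponents.mk p) := by
          ext h
          exact (isLocallyConst_locallyConstantToAlg A h).mem_iff p
        change ofPiZeroSpec k (piZeroSpec A) (ConnectedComponents.mk
          (PrimeSpectrum.comap (locallyConstantToAlg A).toRingHom p)) = ConnectedComponents.mk p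
        exact (congrArg (fun q => ofPiZeroSpec k (piZeroSpec A) (ConnectedComponents.mk q)) h).trans
          (ofPiZeroSpec_toPiZeroSpec k (piZeroSpec A) _) }

/-- Maps from `A ↦ X (π₀|Spec A|)` to `Q` correspond to maps from `X` to the enhanced points of
`Q`. -/
noncomputable def piZeroPresheafHomEquiv (X : Profinite.{u}ᵒᵖ ⥤ Type u)
    (Q : CommAlgCat.{u} k ⥤ Type u) :
    (piZeroPresheaf k X ⟶ Q) ≃ (X ⟶ (enhancedPoints k).obj Q) :=
  ((continuousFunctionsAdj k).whiskerLeft _).homEquiv X Q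

variable {k}

theorem piZeroPresheafHomEquiv_comp {X : Profinite.{u}ᵒᵖ ⥤ Type u}
    {Q Q' : CommAlgCat.{u} k ⥤ Type u} (ι : piZeroPresheaf k X ⟶ Q) (h : Q ⟶ Q') :
    piZeroPresheafHomEquiv k X Q' (ι ≫ h) =
      piZeroPresheafHomEquiv k X Q ι ≫ (enhancedPoints k).map h :=
  ((continuousFunctionsAdj k).whiskerLeft _).homEquiv_naturality_right ι h

theorem map_toPiZeroSpec_piZeroPresheafHomEquiv {X : Profinite.{u}ᵒᵖ ⥤ Type u}
    {Q : CommAlgCat.{u} k ⥤ Type u} (ι : piZeroPresheaf k X ⟶ Q) (S : Profinite.{u}) :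
    X.map (toPiZeroSpec k S).op ≫ (piZeroPresheafHomEquiv k X Q ι).app (op S) =
      ι.app ((continuousFunctions k).obj (op S)) := by
  have h1 (x) : (piZeroPresheafHomEquiv k X Q ι).app (op S) x =
      ι.app ((continuousFunctions k).obj (op S)) (X.map (ofPiZeroSpec k S).op x) := by
    simp [piZeroPresheafHomEquiv]
    rfl
  have h2 : (toPiZeroSpec k S).op ≫ (ofPiZeroSpec k S).op = 𝟙 _ := by
    apply Quiver.Hom.unop_inj
    ext c
    obtain ⟨t, rfl⟩ := (toPiZeroSpec_bijective k S).2 c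
    exact congrArg (toPiZeroSpec k S) (ofPiZeroSpec_toPiZeroSpec k S t)
  ext x
  refine (h1 _).trans (congrArg (ι.app ((continuousFunctions k).obj (op S))) ?_)
  change (X.map (toPiZeroSpec k S).op ≫ X.map (ofPiZeroSpec k S).op) x = x
  rw [← X.map_comp, h2, X.map_id]
  rfl

end Counit

/-! ### Accessibility of the sheafification -/

section SheafificationAccessible

open Cardinal Limits

variable {k : Type u} [Field k]

/-- A homomorphism factors through an injective homomorphism whose range contains its range. -/
theorem CommAlgCat.exists_factor_of_injective {V B B' : CommAlgCat.{u} k} (v : V ⟶ B) (h : B' ⟶ B)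
    (hh : Function.Injective h.hom) (hv : Set.range v.hom ⊆ Set.range h.hom) :
    ∃ w : V ⟶ B', w ≫ h = v := by
  refine ⟨CommAlgCat.ofHom ((AlgEquiv.ofInjective h.hom hh).symm.toAlgHom.comp
    (v.hom.codRestrict h.hom.range fun a => hv ⟨a, rfl⟩)), ?_⟩
  ext a
  exact congrArg Subtype.val ((AlgEquiv.ofInjective h.hom hh).apply_symm_apply _)

/-- The small subalgebras of an algebra. -/
abbrev SmallSubalgebra (A : CommAlgCat.{u} k) (μ : Cardinal.{u}) : Type u :=
  { S : Subalgebra k A // #S ≤ μ }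

namespace SmallSubalgebra

variable (A : CommAlgCat.{u} k) (μ : Cardinal.{u})

/-- The diagram of small subalgebras. -/
def diagram : SmallSubalgebra A μ ⥤ CommAlgCat.{u} k where
  obj S := CommAlgCat.of k S.1
  map f := CommAlgCat.ofHom (Subalgebra.inclusion (leOfHom f))

/-- An algebra as a cocone on its small subalgebras. -/
def cocone : Cocone (diagram A μ) where
  pt := A
  ι := { app S := CommAlgCat.ofHom S.1.val }

variable {μ} (hμ : ℵ₀ ≤ μ) (hk : #k ≤ μ)
include hμ hk

theorem exists_le {K : Type u} (S : K → SmallSubalgebra A μ) (hK : #K ≤ μ) :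
    ∃ T, ∀ i, S i ≤ T := by
  refine ⟨⟨Algebra.adjoin k (⋃ i, ((S i).1 : Set A)),
    Subalgebra.cardinalMk_adjoin_le_of_le hμ hk ?_⟩, fun i a ha => ?_⟩
  · exact Cardinal.mk_iUnion_le_of_le hμ hK fun i => (S i).2
  · exact Algebra.subset_adjoin (Set.mem_iUnion.2 ⟨i, ha⟩)

theorem isCardinalFiltered [Fact (Order.succ μ).IsRegular] :
    IsCardinalFiltered (SmallSubalgebra A μ) (Order.succ μ) :=
  isCardinalFiltered_preorder _ _ fun _ S hK => exists_le A hμ hk S (Order.lt_succ_iff.1 hK)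

theorem exists_mem (s : Set A) (hs : #s ≤ μ) : ∃ S : SmallSubalgebra A μ, s ⊆ S.1 :=
  ⟨⟨Algebra.adjoin k s, Subalgebra.cardinalMk_adjoin_le_of_le hμ hk hs⟩, Algebra.subset_adjoin⟩

theorem nonempty_isColimit : Nonempty (IsColimit (cocone A μ)) := by
  choose S hS using fun a : A => exists_mem A hμ hk {a} (by simpa using one_le_aleph0.trans hμ)
  have hS' (a : A) : a ∈ (S a).1 := hS a rfl
  have key (s : Cocone (diagram A μ)) {T T' : SmallSubalgebra A μ} (h : T ≤ T') (a : A)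
      (ha : a ∈ T.1) : (s.ι.app T).hom ⟨a, ha⟩ = (s.ι.app T').hom ⟨a, h ha⟩ :=
    congrArg (fun φ : (diagram A μ).obj T ⟶ s.pt => φ.hom ⟨a, ha⟩) (s.w (homOfLE h)).symm
  have hdir (T T' : SmallSubalgebra A μ) : ∃ W, T ≤ W ∧ T' ≤ W := by
    obtain ⟨W, hW⟩ := exists_le A hμ hk (fun b : ULift Bool => cond b.down T T')
      (Cardinal.mk_le_aleph0.trans hμ)
    exact ⟨W, hW ⟨true⟩, hW ⟨false⟩⟩
  have key' (s : Cocone (diagram A μ)) (T T' : SmallSubalgebra A μ) (a : A)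
      (ha : a ∈ T.1) (ha' : a ∈ T'.1) : (s.ι.app T).hom ⟨a, ha⟩ = (s.ι.app T').hom ⟨a, ha'⟩ := by
    obtain ⟨W, h, h'⟩ := hdir T T'
    rw [key s h, key s h']
  let d (s : Cocone (diagram A μ)) (a : A) : s.pt := (s.ι.app (S a)).hom ⟨a, hS' a⟩
  have hd (s : Cocone (diagram A μ)) (T) (a : A) (ha : a ∈ T.1) :
    d s a = (s.ι.app T).hom ⟨a, ha⟩ := key' s _ _ _ _ _
  refine ⟨{
    desc s := CommAlgCat.ofHom
      { toFun := d s
        map_one' := (hd s (S 1) 1 (one_mem _)).trans (map_one _)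
        map_zero' := (hd s (S 0) 0 (zero_mem _)).trans (map_zero _)
        map_mul' a b := by
          obtain ⟨W, h, h'⟩ := hdir (S a) (S b)
          rw [hd s W a (h (hS' a)), hd s W b (h' (hS' b)),
            hd s W (a * b) (mul_mem (h (hS' a)) (h' (hS' b)))]
          exact map_mul (s.ι.app W).hom (⟨a, h (hS' a)⟩ : W.1) (⟨b, h' (hS' b)⟩ : W.1)
        map_add' a b := by
          obtain ⟨W, h, h'⟩ := hdir (S a) (S b)
          rw [hd s W a (h (hS' a)), hd s W b (h' (hS' b)),
            hd s W (a + b) (add_mem (h (hS' a)) (h' (hS' b)))]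
          exact map_add (s.ι.app W).hom (⟨a, h (hS' a)⟩ : W.1) (⟨b, h' (hS' b)⟩ : W.1)
        commutes' c := (hd s (S 0) _ (Subalgebra.algebraMap_mem _ c)).trans
          (AlgHom.commutes (s.ι.app (S 0)).hom c) }
    fac s T := by
      ext a
      exact hd s T a.1 a.2
    uniq s m hm := by
      ext a
      exact congrArg (fun φ : (diagram A μ).obj (S a) ⟶ s.pt => φ.hom ⟨a, hS' a⟩) (hm (S a)) }⟩

end SmallSubalgebra

/-- `A` is the `Order.succ μ`-filtered colimit of its subalgebras of size at most `μ`, and `F`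
preserves this colimit. -/
theorem exists_small_of_isCardinalAccessible {F : CommAlgCat.{u} k ⥤ Type u} {μ : Cardinal.{u}}
    (hμ : ℵ₀ ≤ μ) (hk : #k ≤ μ) [Fact (Order.succ μ).IsRegular]
    [F.IsCardinalAccessible (Order.succ μ)] (A : CommAlgCat.{u} k) (p : F.obj A) :
    ∃ (C : CommAlgCat.{u} k) (g : C ⟶ A) (x : F.obj C), #C ≤ μ ∧ F.map g x = p := by
  have := SmallSubalgebra.isCardinalFiltered A hμ hk
  obtain ⟨hc⟩ := SmallSubalgebra.nonempty_isColimit A hμ hk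
  have := F.preservesColimitsOfShape_of_isCardinalAccessible (Order.succ μ) (SmallSubalgebra A μ)
  obtain ⟨S, x, hx⟩ := Types.jointly_surjective_of_isColimit (isColimitOfPreserves F hc) p
  exact ⟨_, _, x, S.2, hx⟩

section

variable {F P : CommAlgCat.{u} k ⥤ Type u} (ι : F ⟶ P) (hP : SatisfiesFpqcDescent P)
  (hι : ∀ A, Function.Injective (ι.app A))
  (hloc : ∀ (A : CommAlgCat.{u} k) (p : P.obj A), ∃ (κ : Type) (_ : Finite κ)
    (B : κ → CommAlgCat.{u} k) (f : ∀ i, A ⟶ B i), IsFpqcFamily B f ∧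
      ∀ i, ∃ x : F.obj (B i), ι.app _ x = P.map (f i) p)
  (hF : ∀ ⦃A B : CommAlgCat.{u} k⦄ (f : A ⟶ B), Function.Injective f.hom →
    Function.Injective (F.map f))
include hP hι hloc hF

/-- On a common cover both sections come from `F`. Its members are flat over `A`, so they inject
into their base changes along `f`, where the sections agree; `F` preserves these injections. -/
theorem map_injective_of_locally_surjective {A A' : CommAlgCat.{u} k} (f : A ⟶ A')
    (hf : Function.Injective f.hom) : Function.Injective (P.map f) := by
  intro p q hpq
  obtain ⟨κ, _, B, b, hb, hx⟩ := hloc A p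
  choose x hx using hx
  choose κ' _ C c hc hy using fun i => hloc (B i) (P.map (b i) q)
  choose y hy using hy
  refine hP.ext (hb.comp hc) fun ⟨i, j⟩ => ?_
  have hflat := (hb.comp hc).flat ⟨i, j⟩
  have hinj := pushoutAlg.injective_inl (b i ≫ c i j) f hflat hf
  obtain ⟨z, hxp⟩ : ∃ z, ι.app _ z = P.map (b i ≫ c i j) p :=
    ⟨F.map (c i j) (x i), by rw [NatTrans.naturality_apply, hx, P.map_comp, comp_apply]⟩
  have hyq : ι.app _ (y i j) = P.map (b i ≫ c i j) q := by
    rw [hy, P.map_comp, comp_apply]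
  rw [← hxp, ← hyq]
  congr 1
  apply hF _ hinj
  apply hι
  rw [NatTrans.naturality_apply, NatTrans.naturality_apply, hxp, hyq, ← comp_apply, ← comp_apply,
    ← P.map_comp, pushoutAlg.condition, P.map_comp, comp_apply, comp_apply, hpq]

/-- Local representatives in `F` live on small algebras, which a small subfamily can be made to
contain. Its overlaps inject into the original ones, so the representatives remain compatible and
glue over the small base. -/
theorem exists_small_of_locally_surjective {μ : Cardinal.{u}} (hμ : ℵ₀ ≤ μ) (hk : #k ≤ μ)
    (hsmall : ∀ (A : CommAlgCat.{u} k) (p : F.obj A), ∃ (C : CommAlgCat.{u} k) (g : C ⟶ A)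
      (x : F.obj C), #C ≤ μ ∧ F.map g x = p) (A : CommAlgCat.{u} k) (p : P.obj A) :
    ∃ (C : CommAlgCat.{u} k) (g : C ⟶ A) (x : P.obj C), #C ≤ μ ∧ P.map g x = p := by
  obtain ⟨κ, _, B, f, hf, hx⟩ := hloc A p
  choose x hx using hx
  choose V v x₀ hV hv using fun i => hsmall (B i) (x i)
  obtain ⟨A', B', f', g, h, e, hf', hA', hh, hU, hover⟩ := hf.exists_small hμ hk
    (fun i => Set.range (v i).hom) fun i => Cardinal.mk_range_le.trans (hV i)
  choose w hw using fun i => CommAlgCat.exists_factor_of_injective (v i) (h i) (hh i) (hU i)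
  obtain ⟨x', hx'⟩ : ∃ x' : ∀ i, F.obj (B' i), ∀ i, F.map (h i) (x' i) = x i :=
    ⟨fun i => F.map (w i) (x₀ i), fun i => by rw [← hv i, ← hw i, F.map_comp, comp_apply]⟩
  obtain ⟨a, ha, -⟩ := hP.existsUnique hf' (fun i => ι.app _ (x' i)) fun i j => by
    rw [← NatTrans.naturality_apply, ← NatTrans.naturality_apply]
    congr 1
    apply hF _ (hover i j)
    rw [← comp_apply, ← comp_apply, ← F.map_comp, ← F.map_comp, pushoutAlg.inl_desc,
      pushoutAlg.inr_desc, F.map_comp, F.map_comp, comp_apply, comp_apply, hx', hx']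
    apply hι
    rw [NatTrans.naturality_apply, NatTrans.naturality_apply, hx, hx, ← comp_apply, ← comp_apply,
      ← P.map_comp, ← P.map_comp, pushoutAlg.condition]
  refine ⟨A', g, a, hA', hP.ext hf fun i => ?_⟩
  rw [← hx, ← hx', NatTrans.naturality_apply, ← ha, ← comp_apply, ← comp_apply, ← P.map_comp,
    ← P.map_comp, e]

theorem isAccessible_of_locally_surjective [F.IsAccessible.{u}] : P.IsAccessible.{u} := by
  obtain ⟨κ, _, _⟩ := Functor.IsAccessible.exists_cardinal.{u} (F := F)
  -- The bounds `ℵ₀` and `#k` keep generated subalgebras of size at most `μ`; the bound `κ` makes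
  -- `F` accessible for `Order.succ μ`.
  let μ : Cardinal.{u} := max (max ℵ₀ #k) κ
  have hμ : ℵ₀ ≤ μ := (le_max_left _ _).trans (le_max_left _ _)
  have hk : #k ≤ μ := (le_max_right _ _).trans (le_max_left _ _)
  have : Fact (Order.succ μ).IsRegular := ⟨isRegular_succ hμ⟩
  have := F.isCardinalAccessible_of_le ((le_max_right _ _ : κ ≤ μ).trans (Order.le_succ μ))
  have := isCardinalAccessible_succ_of_injective hμ hk
    (fun A B f hf => map_injective_of_locally_surjective ι hP hι hloc hF f hf)
    (exists_small_of_locally_surjective ι hP hι hloc hF hμ hk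
      (exists_small_of_isCardinalAccessible hμ hk))
  exact P.isAccessible_of_isCardinalAccessible (Order.succ μ)

end

end SheafificationAccessible

/-! ### Affine schemes as accessible sheaves; the case of profinite sets -/

section SpecFunctor

open scoped TensorProduct
open Cardinal Limits

/-- Descent of elements along a finite faithfully flat family of algebras. -/
theorem Algebra.exists_algebraMap_eq_of_tmul_eq {A : Type*} [CommRing A] {ι : Type*} [Finite ι]
    {B : ι → Type*} [∀ i, CommRing (B i)] [∀ i, Algebra A (B i)] [∀ i, Module.Flat A (B i)]
    (hsurj : ∀ p : PrimeSpectrum A, ∃ (i : ι) (q : PrimeSpectrum (B i)),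
      PrimeSpectrum.comap (algebraMap A (B i)) q = p) :
    (∀ a : A, (∀ i, algebraMap A (B i) a = 0) → a = 0) ∧
    ∀ b : ∀ i, B i, (∀ i j, b i ⊗ₜ[A] (1 : B j) = (1 : B i) ⊗ₜ[A] b j) →
      ∃ a, ∀ i, algebraMap A (B i) a = b i := by
  classical
  have := Fintype.ofFinite ι
  have hff : Module.FaithfullyFlat A (∀ i, B i) := by
    have : Module.Flat A (∀ i, B i) :=
      .of_linearEquiv (DFinsupp.linearEquivFunOnFintype (R := A) (M := B)).symm
    refine Module.FaithfullyFlat.of_comap_surjective fun p => ?_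
    obtain ⟨i, q, rfl⟩ := hsurj p
    exact ⟨PrimeSpectrum.comap (Pi.evalRingHom B i) q, rfl⟩
  refine ⟨fun a ha => FaithfulSMul.algebraMap_injective A (∀ i, B i)
    ((funext ha).trans (map_zero _).symm), fun b hb => ?_⟩
  have hexact := Algebra.IsEffective.of_faithfullyFlat A (∀ i, B i)
  obtain ⟨a, ha⟩ := (hexact b).1 (by
    -- Decomposing `b` and `1` into components reduces the equalizer condition for the product
    -- algebra to the conditions on pairs.
    have hsum (c : ∀ i, B i) : c = ∑ i, LinearMap.single A B i (c i) :=
      (LinearMap.sum_single_apply _ c).symm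
    have h1 := congrArg₂ (fun x y => x ⊗ₜ[A] y) (hsum b) (hsum 1)
    have h2 := congrArg₂ (fun x y => x ⊗ₜ[A] y) (hsum 1) (hsum b)
    rw [TensorProduct.includeLeftSubRight_apply, sub_eq_zero]
    refine h1.trans (Eq.trans ?_ h2.symm)
    simp only [TensorProduct.sum_tmul, TensorProduct.tmul_sum]
    refine Finset.sum_congr rfl fun i _ => Finset.sum_congr rfl fun j _ => ?_
    exact congrArg (_root_.TensorProduct.map (LinearMap.single A B j) (LinearMap.single A B i)) (hb j i))
  exact ⟨a, fun i => congrFun ha i⟩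

variable {k : Type u} [Field k]

theorem IsFpqcFamily.existsUnique {A : CommAlgCat.{u} k} {ι : Type} [Finite ι]
    {B : ι → CommAlgCat.{u} k} {f : ∀ i, A ⟶ B i} (hf : IsFpqcFamily B f) (b : ∀ i, B i)
    (hb : ∀ i j, (pushoutAlg.inl (f i) (f j)).hom (b i) = (pushoutAlg.inr (f i) (f j)).hom (b j)) :
    ∃! a, ∀ i, (f i).hom a = b i := by
  let _ (i : ι) := (f i).hom.toRingHom.toAlgebra
  have hflat (i : ι) : Module.Flat A (B i) := hf.flat i
  obtain ⟨h1, h2⟩ := Algebra.exists_algebraMap_eq_of_tmul_eq (A := A) (B := fun i => B i) hf.surj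
  obtain ⟨a, ha⟩ := h2 b hb
  refine ⟨a, ha, fun a' ha' => sub_eq_zero.1 (h1 _ fun i => ?_)⟩
  rw [map_sub, sub_eq_zero]
  exact (ha' i).trans (ha i).symm

variable (k) in
-- Images of elements of `R` descend one at a time; uniqueness of descent makes the resulting map a
-- homomorphism.
theorem satisfiesFpqcDescent_specFunctor (R : CommAlgCat.{u} k) :
    SatisfiesFpqcDescent (specFunctor k R) := by
  refine satisfiesFpqcDescent_of_existsUnique fun A ι _ B f hf φ hφ => ?_
  choose a ha huniq using fun r : R => hf.existsUnique (fun i => (show R ⟶ B i from φ i).hom r)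
    fun i j => congrArg (fun ψ : R ⟶ pushoutAlg (f i) (f j) => ψ.hom r) (hφ i j)
  let ψ : R →ₐ[k] A :=
    { toFun := a
      map_one' := (huniq 1 1 fun i => by rw [map_one, map_one]).symm
      map_zero' := (huniq 0 0 fun i => by rw [map_zero, map_zero]).symm
      map_mul' x y := (huniq _ _ fun i => by rw [map_mul, map_mul, ha, ha]).symm
      map_add' x y := (huniq _ _ fun i => by rw [map_add, map_add, ha, ha]).symm
      commutes' c := (huniq _ _ fun i => by rw [AlgHom.commutes, AlgHom.commutes]).symm }
  refine ⟨CommAlgCat.ofHom ψ, fun i => ?_, fun χ hχ => ?_⟩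
  · exact CommAlgCat.hom_ext (AlgHom.ext fun r => ha r i)
  · exact CommAlgCat.hom_ext (AlgHom.ext fun r => huniq r _ fun i =>
      congrArg (fun ψ : R ⟶ B i => ψ.hom r) (hχ i))

variable (k) in
theorem isAccessible_specFunctor (R : CommAlgCat.{u} k) : (specFunctor k R).IsAccessible.{u} := by
  let μ : Cardinal.{u} := max (max ℵ₀ #k) #R
  have hμ : ℵ₀ ≤ μ := (le_max_left _ _).trans (le_max_left _ _)
  have hk : #k ≤ μ := (le_max_right _ _).trans (le_max_left _ _)
  have : Fact (Order.succ μ).IsRegular := ⟨isRegular_succ hμ⟩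
  have := isCardinalAccessible_succ_of_injective (P := specFunctor k R) hμ hk
    (fun A B f hf x y hxy => CommAlgCat.hom_ext (AlgHom.ext fun r =>
      hf (congrArg (fun ψ : R ⟶ B => ψ.hom r) hxy)))
    fun A φ => ⟨R, φ, 𝟙 R, le_max_right _ _, Category.id_comp (X := R) φ⟩
  exact Functor.isAccessible_of_isCardinalAccessible _ (Order.succ μ)

variable (k) in
theorem isIso_continuousFunctionsAdj_unit : IsIso (continuousFunctionsAdj k).unit := by
  have h (S : Profinite.{u}ᵒᵖ) : IsIso ((continuousFunctionsAdj k).unit.app S) := by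
    change IsIso (ofPiZeroSpec k S.unop).op
    have : IsIso (toPiZeroSpec k S.unop) :=
      CompHausLike.isIso_of_bijective _ (toPiZeroSpec_bijective k S.unop)
    have : IsIso (ofPiZeroSpec k S.unop) :=
      inferInstanceAs (IsIso (inv (toPiZeroSpec k S.unop)))
    infer_instance
  exact NatIso.isIso_of_isIso_app _

variable (k) in
theorem profiniteUnit_app_bijective (S : Profinite.{u}) (T : Profinite.{u}ᵒᵖ) :
    Function.Bijective ((profiniteUnit k S).app T) := by
  have := isIso_continuousFunctionsAdj_unit k
  have hff := (continuousFunctionsAdj k).fullyFaithfulLOfIsIsoUnit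
  constructor
  · intro f g h
    exact Quiver.Hom.op_inj (hff.map_injective h)
  · intro φ
    obtain ⟨f, hf⟩ := hff.map_surjective (X := op S) (Y := T) φ
    exact ⟨f.unop, hf⟩

/-- For accessibility an auxiliary field is used: full faithfulness of $\mathcal C(-,k)$ identifies
$\mathrm{Hom}(T,S)$ with $\mathrm{Hom}_k(\mathcal C(S,k),\mathcal C(T,k))$, an accessible functor
composed with a left adjoint. -/
theorem isCondensedSet_yoneda (S : Profinite.{u}) : IsCondensedSet (yoneda.obj S) where
  isSheaf := (isSheaf_iff_isSheaf_of_type _ _).2 (coherentTopology.isSheaf_yoneda_obj S)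
  isAccessible := by
    let k : Type u := ULift.{u} ℚ
    have h (T : Profinite.{u}ᵒᵖ) : IsIso ((profiniteUnit k S).app T) :=
      (isIso_iff_bijective _).2 (profiniteUnit_app_bijective k S T)
    have : IsIso (profiniteUnit k S) := NatIso.isIso_of_isIso_app _
    obtain ⟨κ, _, _⟩ := (isAccessible_specFunctor k
      ((continuousFunctions k).obj (op S))).exists_cardinal
    have := (continuousFunctionsAdj k).leftAdjoint_preservesColimits
    have : ((enhancedPoints k).obj (specFunctor k ((continuousFunctions k).obj
      (op S)))).IsCardinalAccessible κ := inferInstanceAs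
        ((continuousFunctions k ⋙ specFunctor k _).IsCardinalAccessible κ)
    have := Functor.isCardinalAccessible_of_natIso (asIso (profiniteUnit k S)).symm κ
    exact Functor.isAccessible_of_isCardinalAccessible _ κ

variable (k) in
/-- The pétra space of a profinite set is the spectrum of its algebra of continuous functions. -/
theorem isPetraSpace_yoneda (S : Profinite.{u}) :
    IsPetraSpace (yoneda.obj S) (specFunctor k ((continuousFunctions k).obj (op S)))
      (profiniteUnit k S) where
  isCondensedSet := isCondensedSet_yoneda S
  isFpqcSheaf := ⟨satisfiesFpqcDescent_specFunctor k _, isAccessible_specFunctor k _⟩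
  existsUnique_fac Q _ g := by
    -- By Yoneda, both `h` and `g` are determined by an element of $Q(\mathcal C(S,k))$.
    have key (h : specFunctor k ((continuousFunctions k).obj (op S)) ⟶ Q) :
        profiniteUnit k S ≫ (enhancedPoints k).map h = g ↔
          coyonedaEquiv h = g.app (op S) (𝟙 S) := by
      have h1 : (profiniteUnit k S ≫ (enhancedPoints k).map h).app (op S) (𝟙 S) =
          coyonedaEquiv h :=
        congrArg (h.app _) ((continuousFunctions k).map_id (op S))
      rw [← h1, ← yonedaEquiv.injective.eq_iff]
      rfl
    refine ⟨coyonedaEquiv.symm (g.app (op S) (𝟙 S)), (key _).2 (Equiv.apply_symm_apply _ _),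
      fun h hh => ?_⟩
    exact coyonedaEquiv.eq_symm_apply.2 ((key h).1 hh)

end SpecFunctor

/-! ### Pétra spaces as sheafifications -/

section Petra

variable {k : Type u} [Field k] {X : Profinite.{u}ᵒᵖ ⥤ Type u}

theorem IsCondensedSet.isAccessible_piZeroPresheaf (hX : IsCondensedSet X) :
    (piZeroPresheaf k X).IsAccessible.{u} := by
  obtain ⟨κ, _, _⟩ := hX.isAccessible.exists_cardinal
  have := isCardinalAccessible_piZeroSpecFunctor (k := k) κ
  have : (piZeroPresheaf k X).IsCardinalAccessible κ :=
    inferInstanceAs ((piZeroSpecFunctor k ⋙ X).IsCardinalAccessible κ)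
  exact Functor.isAccessible_of_isCardinalAccessible _ κ

theorem IsCondensedSet.exists_isFpqcSheafification (hX : IsCondensedSet X) :
    ∃ (P : CommAlgCat.{u} k ⥤ Type u) (ι : piZeroPresheaf k X ⟶ P), IsFpqcSheafification ι := by
  obtain ⟨P, ι, hP, hι, hloc, huniv⟩ := hX.exists_piZeroPresheaf_sheafification (k := k)
  have := hX.isAccessible_piZeroPresheaf (k := k)
  exact ⟨P, ι, ⟨hP, isAccessible_of_locally_surjective ι hP hι hloc
    fun A B f hf => hX.injective_piZeroPresheaf_map f hf⟩, huniv⟩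

/-- A sheafification of `A ↦ X (π₀|Spec A|)` is a pétra space of `X`. -/
theorem IsFpqcSheafification.isPetraSpace {P : CommAlgCat.{u} k ⥤ Type u}
    {ι : piZeroPresheaf k X ⟶ P} (hι : IsFpqcSheafification ι) (hX : IsCondensedSet X) :
    IsPetraSpace X P (piZeroPresheafHomEquiv k X P ι) where
  isCondensedSet := hX
  isFpqcSheaf := hι.isFpqcSheaf
  existsUnique_fac Q hQ g := by
    obtain ⟨g, rfl⟩ := (piZeroPresheafHomEquiv k X Q).surjective g
    simp only [← piZeroPresheafHomEquiv_comp, EmbeddingLike.apply_eq_iff_eq]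
    exact hι.existsUnique_fac Q hQ.isSheaf g

/-- Pétra spaces are unique up to isomorphism. -/
theorem IsPetraSpace.exists_iso {P P' : CommAlgCat.{u} k ⥤ Type u}
    {η : X ⟶ (enhancedPoints k).obj P} {η' : X ⟶ (enhancedPoints k).obj P'}
    (h : IsPetraSpace X P η) (h' : IsPetraSpace X P' η') :
    ∃ e : P ≅ P', η ≫ (enhancedPoints k).map e.hom = η' := by
  obtain ⟨a, ha, -⟩ := h.existsUnique_fac P' h'.isFpqcSheaf η'
  obtain ⟨b, hb, -⟩ := h'.existsUnique_fac P h.isFpqcSheaf η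
  refine ⟨⟨a, b, ?_, ?_⟩, ha⟩
  · refine (h.existsUnique_fac P h.isFpqcSheaf η).unique ?_ ?_
    · rw [Functor.map_comp, ← Category.assoc, ha, hb]
    · rw [CategoryTheory.Functor.map_id, Category.comp_id]
  · refine (h'.existsUnique_fac P' h'.isFpqcSheaf η').unique ?_ ?_
    · rw [Functor.map_comp, ← Category.assoc, hb, ha]
    · rw [CategoryTheory.Functor.map_id, Category.comp_id]

/-- The pétra property tests only accessible sheaves. The stronger universal property, against all
sheaves, is transported from the constructed sheafification along the unique comparison isomorphism.
-/
theorem IsPetraSpace.isFpqcSheafification {P : CommAlgCat.{u} k ⥤ Type u}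
    {ι : piZeroPresheaf k X ⟶ P} (h : IsPetraSpace X P (piZeroPresheafHomEquiv k X P ι)) :
    IsFpqcSheafification ι := by
  obtain ⟨P', ι', hι'⟩ := h.isCondensedSet.exists_isFpqcSheafification (k := k)
  obtain ⟨e, he⟩ := (hι'.isPetraSpace h.isCondensedSet).exists_iso h
  rw [← piZeroPresheafHomEquiv_comp, EmbeddingLike.apply_eq_iff_eq] at he
  refine ⟨h.isFpqcSheaf, fun Q hQ g => ?_⟩
  obtain ⟨a, ha, huniq⟩ := hι'.existsUnique_fac Q hQ g
  refine ⟨e.inv ≫ a, ?_, fun b hb => ?_⟩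
  · rw [← he]
    simpa using ha
  · rw [Iso.eq_inv_comp]
    refine huniq _ ?_
    rw [← hb, ← he, Category.assoc]

end Petra

theorem mainTheorem9 (k : Type u) [Field k] :
    (∀ X : Profinite.{u}ᵒᵖ ⥤ Type u, IsCondensedSet X →
      (piZeroPresheaf k X).IsAccessible.{u} ∧
      (∃ (P : CommAlgCat.{u} k ⥤ Type u) (η : X ⟶ (enhancedPoints k).obj P),
        IsPetraSpace X P η) ∧
      ∀ (P : CommAlgCat.{u} k ⥤ Type u) (η : X ⟶ (enhancedPoints k).obj P),
        IsPetraSpace X P η →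
          ∃ ι : piZeroPresheaf k X ⟶ P,
            (∀ S : Profinite.{u}, X.map (toPiZeroSpec k S).op ≫ η.app (op S) =
              ι.app ((continuousFunctions k).obj (op S))) ∧
            IsFpqcSheafification ι) ∧
    ∀ S : Profinite.{u},
      IsPetraSpace (yoneda.obj S) (specFunctor k ((continuousFunctions k).obj (op S)))
        (profiniteUnit k S) := by
  refine ⟨fun X hX => ⟨hX.isAccessible_piZeroPresheaf, ?_, fun P η hη => ?_⟩, isPetraSpace_yoneda k⟩
  · obtain ⟨P, ι, hι⟩ := hX.exists_isFpqcSheafification (k := k)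
    exact ⟨P, _, hι.isPetraSpace hX⟩
  · obtain ⟨ι, rfl⟩ := (piZeroPresheafHomEquiv k X P).surjective η
    exact ⟨ι, map_toPiZeroSpec_piZeroPresheafHomEquiv ι, hη.isFpqcSheafification⟩
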